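/- A ball tangle diagram is a diagram, in a disk in the plane and up to isotopy of the plane, of a compact 1-dimensional submanifold of the 3-ball, properly embedded, whose boundary consists of four fixed points NW, NE, SE, SW (in this clockwise order on the boundary circle of the disk); any finite number of closed components is allowed. Let $BT$ be the class of all ball tangle diagrams. For $B\in BT$ let $B_1$ (the numerator closure) be the link diagram obtained from $B$ by joining NW to NE and SW to SE by two disjoint arcs outside the disk, and let $B_2$ (the denominator closure) be obtained by joining NW to SW and NE to SE in the same way. For a link diagram $L$ let $$\langle L\rangle=\sum_{\sigma}A^{\alpha(\sigma)}(A^{-1})^{\beta(\sigma)}(-A^2-A^{-2})^{d(\sigma)-1},\qquad A=e^{i\pi/4},$$ be its Kauffman bracket. The sum is over all states $\sigma$, that is, all choices of an $A$-type or a $B$-type splitting at each crossing; $\alpha(\sigma)$ and $\beta(\sigma)$ are the numbers of crossings with $A$-type and $B$-type splitting, and $d(\sigma)$ is the number of circles in the split diagram. (At a crossing, the $A$-regions are the two regions swept by the over-strand when it is rotated counterclockwise; the $A$-type splitting opens a channel between them, and the $B$-type splitting one between the other two regions.) Let $PM_{2\times1}(\mathbb Z)$ be the quotient of the set $M_{2\times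 1}(\mathbb Z)$ of integer column vectors by multiplication by $\pm1$, its elements being regarded as the sets $\{v,-v\}$. Theorem 4.4. The formula $$f(B)=\left\{\begin{pmatrix} z\langle B_1\rangle\\ iz\langle B_2\rangle\end{pmatrix}\;:\; z\in\mathbb C,\ z^8=1\right\}\cap M_{2\times1}(\mathbb Z)$$ gives a well-defined map $f=F^0:BT\to PM_{2\times1}(\mathbb Z)$ (Krebes' ball tangle invariant), and this map is surjective. -/

import Mathlib

noncomputable section

/-!
# Diagrams, coded combinatorially

Planar diagrams are encoded, up to isotopy of the projection plane, by the rotation system of the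
underlying plane graph.  A diagram has finitely many crossings and finitely many marked points.
A marked point is an ordinary point of a strand; marking points does not alter the picture, but
every component without crossings and without end points has to carry at least one of them (so a
crossingless circle is a circle with a marked point on it).
Cutting the diagram at the crossings and at the marked points leaves arcs; the ends of the arcs
are called darts.

* At a crossing `c` there are four darts `(c, 0), (c, 1), (c, 2), (c, 3)`, listed
  counterclockwise, so that the understrand joins `0` to `2` and the overstrand joins `1` to `3`.
* At a marked point `j` there are two darts `(j, 0), (j, 1)`.
-/

/-- The darts at the crossings (indexed by `X`) and at the marked points (indexed by `J`). -/
abbrev Dart (X J : Type) : Type := (X × Fin 4) ⊕ (J × Fin 2)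

/-- The number of equivalence classes of the equivalence relation generated by `r`. -/
def numClasses {D : Type} (r : D → D → Prop) : ℕ := Nat.card (Quot r)

/-- A map on an oriented closed surface, given by the rotation `rot` about the vertices and the
involution `arc` which interchanges the two ends of every edge, is planar: Euler's formula
`V - E + F = 2 C` holds, with `C` the number of connected components.  (Each component satisfies
`V - E + F = 2 - 2 * genus`, so this says that all components have genus zero.) -/
def IsPlanarMap {D : Type} (rot arc : D → D) : Prop :=
  numClasses (fun d d' => d' = rot d) + numClasses (fun d d' => d' = rot (arc d)) =
    numClasses (fun d d' => d' = arc d) + 2 * numClasses (fun d d' => d' = rot d ∨ d' = arc d)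

/-! ## Link diagrams and the Kauffman bracket -/

/-- The code of a link diagram: `arc` sends each end of an arc to the other end of that arc.
The Kauffman bracket is a state sum over such a code and does not involve planarity; it is applied
below only to the closures of planar ball tangle diagrams. -/
structure LinkCode where
  Crossing : Type
  Mark : Type
  [fintypeCrossing : Fintype Crossing]
  [decEqCrossing : DecidableEq Crossing]
  [fintypeMark : Fintype Mark]
  arc : Dart Crossing Mark → Dart Crossing Mark
  arc_arc : ∀ d, arc (arc d) = d
  arc_ne : ∀ d, arc d ≠ d

attribute [instance] LinkCode.fintypeCrossing LinkCode.decEqCrossing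
  LinkCode.fintypeMark

/-- The two ways of splitting a crossing. -/
inductive Splitting where
  | A
  | B
  deriving DecidableEq

instance : Fintype Splitting := ⟨{.A, .B}, fun s => by cases s <;> simp⟩

/-- How a splitting reconnects the four darts at a crossing.  Rotating the overstrand `1, 3`
counterclockwise sweeps the regions between `1` and `2` and between `3` and `0`: these are the
`A`-regions.  Opening a channel between them joins `0` to `1` and `2` to `3`; opening a channel
between the other two regions joins `1` to `2` and `3` to `0`. -/
def Splitting.partner : Splitting → Fin 4 → Fin 4
  | .A => ![1, 0, 3, 2]
  | .B => ![3, 2, 1, 0]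

namespace LinkCode

variable (L : LinkCode)

/-- A state chooses a splitting at every crossing. -/
abbrev State : Type := L.Crossing → Splitting

/-- How the darts are joined at the former crossings and at the marked points, once the diagram
has been split by the state `σ`. -/
def join (σ : L.State) : Dart L.Crossing L.Mark → Dart L.Crossing L.Mark
  | .inl (c, i) => .inl (c, (σ c).partner i)
  | .inr (j, i) => .inr (j, i + 1)

/-- The number `d(σ)` of circles in the diagram split by `σ`. -/
def numCircles (σ : L.State) : ℕ :=
  numClasses (fun d d' => d' = L.arc d ∨ d' = L.join σ d)

/-- The Kauffman bracket at `A`, as a sum over all states; `d(σ) ≥ 1` if `L` is not empty. -/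
def bracket (A : ℂ) : ℂ :=
  ∑ σ : L.State,
    A ^ (Finset.univ.filter fun c => σ c = .A).card *
      A⁻¹ ^ (Finset.univ.filter fun c => σ c = .B).card *
        (-A ^ 2 - A⁻¹ ^ 2) ^ (L.numCircles σ - 1)

end LinkCode

/-! ## Ball tangle diagrams -/

/-- The rotation system of a diagram in a disk with four end points on the boundary circle, the
outside of the disk being regarded as one more vertex, of valence four, on the sphere.  The darts
of the outer vertex are the end points `0 = NW`, `1 = NE`, `2 = SE`, `3 = SW`.  They are in
clockwise order as seen from inside the disk, which is counterclockwise about the outer vertex. -/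
def tangleRot {X J : Type} : Dart X J ⊕ Fin 4 → Dart X J ⊕ Fin 4
  | .inl (.inl (c, i)) => .inl (.inl (c, i + 1))
  | .inl (.inr (j, i)) => .inl (.inr (j, i + 1))
  | .inr i => .inr (i + 1)

/-- A ball tangle diagram: a diagram in the disk with four end points `0 = NW`, `1 = NE`,
`2 = SE`, `3 = SW`.  It may have any finite number of closed components. -/
structure BallTangleDiagram where
  Crossing : Type
  Mark : Type
  [fintypeCrossing : Fintype Crossing]
  [decEqCrossing : DecidableEq Crossing]
  [fintypeMark : Fintype Mark]
  arc : Dart Crossing Mark ⊕ Fin 4 → Dart Crossing Mark ⊕ Fin 4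
  arc_arc : ∀ d, arc (arc d) = d
  arc_ne : ∀ d, arc d ≠ d
  planar : IsPlanarMap tangleRot arc

attribute [instance] BallTangleDiagram.fintypeCrossing BallTangleDiagram.decEqCrossing
  BallTangleDiagram.fintypeMark

/-- The end points as ends of the two outer arcs of the numerator closure:
arc `0` joins `NW` to `NE`, arc `1` joins `SE` to `SW`. -/
def numeratorEnds : Fin 4 ≃ Fin 2 × Fin 2 where
  toFun := ![(0, 0), (0, 1), (1, 0), (1, 1)]
  invFun p := (![![0, 1], ![2, 3]] : Fin 2 → Fin 2 → Fin 4) p.1 p.2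
  left_inv := by decide
  right_inv := by decide

/-- The end points as ends of the two outer arcs of the denominator closure:
arc `0` joins `NE` to `SE`, arc `1` joins `SW` to `NW`. -/
def denominatorEnds : Fin 4 ≃ Fin 2 × Fin 2 where
  toFun := ![(1, 1), (0, 0), (0, 1), (1, 0)]
  invFun p := (![![1, 2], ![3, 0]] : Fin 2 → Fin 2 → Fin 4) p.1 p.2
  left_inv := by decide
  right_inv := by decide

/-- Each of the two outer arcs becomes a new marked point of the closed diagram. -/
def closeDarts (X J : Type) (g : Fin 4 ≃ Fin 2 × Fin 2) :
    Dart X J ⊕ Fin 4 ≃ Dart X (J ⊕ Fin 2) :=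
  (Equiv.sumAssoc (X × Fin 4) (J × Fin 2) (Fin 4)).trans
    (Equiv.sumCongr (Equiv.refl (X × Fin 4))
      ((Equiv.sumCongr (Equiv.refl (J × Fin 2)) g).trans
        (Equiv.sumProdDistrib J (Fin 2) (Fin 2)).symm))

namespace BallTangleDiagram

variable (B : BallTangleDiagram)

/-- The link diagram obtained by joining the end points by two arcs outside the disk. -/
def close (g : Fin 4 ≃ Fin 2 × Fin 2) : LinkCode where
  Crossing := B.Crossing
  Mark := B.Mark ⊕ Fin 2
  arc d := closeDarts B.Crossing B.Mark g (B.arc ((closeDarts B.Crossing B.Mark g).symm d))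
  arc_arc d := by simp [B.arc_arc]
  arc_ne d h := B.arc_ne _ ((Equiv.eq_symm_apply _).2 h)

/-- The numerator closure `B₁`. -/
def numerator : LinkCode := B.close numeratorEnds

/-- The denominator closure `B₂`. -/
def denominator : LinkCode := B.close denominatorEnds

/-- The set of integer matrices among the columns `(z ⟨B₁⟩, i z ⟨B₂⟩)` with `z` an eighth root of
unity, where the brackets are taken at `A = exp (i π / 4)`. -/
def krebesSet : Set (Matrix (Fin 2) (Fin 1) ℤ) :=
  {M | ∃ z : ℂ, z ^ 8 = 1 ∧
    M.map (Int.cast : ℤ → ℂ) =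
      !![z * B.numerator.bracket (Complex.exp (Complex.I * Real.pi / 4));
         Complex.I * z * B.denominator.bracket (Complex.exp (Complex.I * Real.pi / 4))]}

end BallTangleDiagram

/-! ## Krebes' invariant -/

/-- `PM m n`: the `m × n` integer matrices modulo multiplication by the units `±1` of `ℤ`. -/
abbrev PM (m n : ℕ) : Type := MulAction.orbitRel.Quotient ℤˣ (Matrix (Fin m) (Fin n) ℤ)

/-- `f` is Krebes' ball tangle invariant: `f B`, as the class `{v, -v}` of integer matrices, is
the set `krebesSet B`.  A class is determined by its set of elements, so there is at most one
such `f`. -/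
def IsKrebesInvariant (f : BallTangleDiagram → PM 2 1) : Prop :=
  ∀ B : BallTangleDiagram, (f B).orbit = B.krebesSet

end

noncomputable section

/-! ## Euler's formula and checkerboard colourings -/

/-! At `A = exp (iπ/4)` a loop has the value `-A² - A⁻² = 0`, so only states with a single circle
contribute to a bracket. Regard the outside of the disk as one more crossing, split `A` for the
numerator closure and `B` for the denominator closure.

Well-definedness rests on a parity statement, `exists_prod_sgn_eq`: among all one-circle states of
this extended diagram, the number of `B`-splittings, including the outer one, has constant parity.
The darts carry a checkerboard colouring (`exists_checkerboard`, from the vanishing of first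
homology modulo two of a planar map), and following the strands of a state permutes the darts of one
colour. Changing one splitting multiplies this permutation by a transposition, while for one circle
it is a single full cycle, whose sign is fixed. A `B`-splitting weighs `-i` relative to an
`A`-splitting, so all terms of one bracket agree up to sign, and the two brackets are integer
multiples of `Aⁿ u` and `Aⁿ u'` with `u² = -u'²`. The factor `i` in the second entry compensates,
and a suitable eighth root of unity makes both entries integers. Two such roots give the same column
up to sign, by comparing moduli (`eq_or_eq_neg_of_mem_krebesSet`).

Surjectivity comes from operations on tangles. A quarter turn acts by `(p, q) ↦ (q, -p)`, and an
added crossing by `(p, q) ↦ (p + q, q)`; these suffice for Euclid's algorithm. They preserve the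
gcd, so arbitrary gcds need a third operation, which closes a tangle off and gives `(0, p)`.
Starting from `(0, 1)` one reaches `(m, 1)`, then `(0, m)`, then every column (`isKrebesValue`). All
three operations are gluings into an annulus diagram: `IsPlanarGluing.isPlanarMap` transfers
planarity, and `circles_glue_of_splitsTo` and `circles_glue_of_hasCircle` reduce the circle counts
to finite checks. -/

/-- The incidence matrix, modulo two, of the classes given by the fibres of `p`. -/
def incidence {D Q : Type} [DecidableEq Q] (p : D → Q) : Matrix Q D (ZMod 2) :=
  Matrix.of fun q d => if p d = q then 1 else 0

open Matrix in
lemma incidence_mulVec {D Q : Type} [DecidableEq Q] [Fintype D] (p : D → Q) (h : D → ZMod 2)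
    (q : Q) : (incidence p *ᵥ h) q = ∑ d with p d = q, h d := by
  simp [incidence, Matrix.mulVec, dotProduct, Finset.sum_filter]

open Matrix in
lemma incidence_transpose_mulVec {D Q : Type} [DecidableEq Q] [Fintype Q] (p : D → Q)
    (g : Q → ZMod 2) : (incidence p)ᵀ *ᵥ g = g ∘ p := by
  ext d
  simp [incidence, Matrix.mulVec, dotProduct]

/-- The classes of the ends of edges. -/
abbrev EdgeClass {D : Type} (arc : D → D) : Type := Quot fun d d' : D => d' = arc d

lemma edgeClass_eq_iff {D : Type} {arc : D → D} (harc : ∀ d, arc (arc d) = d) (d d' : D) :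
    (Quot.mk _ d' : EdgeClass arc) = Quot.mk _ d ↔ d' = d ∨ d' = arc d := by
  constructor
  · intro h
    have h' := Quot.eqvGen_exact h
    clear h
    induction h' with
    | rel x y h => right; rw [h, harc]
    | refl x => exact Or.inl rfl
    | symm x y _ ih => rcases ih with rfl | rfl <;> simp [harc]
    | trans x y z _ _ ih1 ih2 =>
      rcases ih1 with rfl | rfl
      · exact ih2
      · rcases ih2 with rfl | rfl <;> simp [harc]
  · rintro (rfl | rfl)
    · rfl
    · exact (Quot.sound (r := fun d d' : D => d' = arc d) rfl).symm

instance quotFintype {D : Type} [Finite D] (r : D → D → Prop) : Fintype (Quot r) :=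
  Fintype.ofFinite _

section Euler

open Matrix Classical

variable {D Q : Type} [Fintype D] [Fintype Q]

/-- The sum, modulo two, of a function on `Q` over the two ends of every edge. -/
def boundary (arc : D → D) (p : D → Q) : Matrix (EdgeClass arc) Q (ZMod 2) :=
  incidence (Quot.mk _ : D → EdgeClass arc) * (incidence p)ᵀ

lemma edge_sum {arc : D → D} (harc : ∀ d, arc (arc d) = d) (hne : ∀ d, arc d ≠ d)
    (h : D → ZMod 2) (d : D) :
    ∑ d' with (Quot.mk _ d' : EdgeClass arc) = Quot.mk _ d, h d' = h d + h (arc d) := by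
  rw [← Finset.sum_pair (hne d).symm]
  congr 1
  ext d'
  simp [edgeClass_eq_iff harc]

lemma boundary_mulVec {arc : D → D} (harc : ∀ d, arc (arc d) = d) (hne : ∀ d, arc d ≠ d)
    (p : D → Q) (g : Q → ZMod 2) (d : D) :
    (boundary arc p *ᵥ g) (Quot.mk _ d) = g (p d) + g (p (arc d)) := by
  rw [boundary, ← Matrix.mulVec_mulVec, incidence_transpose_mulVec, incidence_mulVec,
    edge_sum harc hne]
  rfl

/-- A kernel vector takes equal values at the two ends of every edge, hence is constant on connected
components. The hypothesis `hrot` lets the same argument serve vertices and faces. -/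
lemma finrank_ker_boundary_le {rot arc : D → D} (harc : ∀ d, arc (arc d) = d)
    (hne : ∀ d, arc d ≠ d) {p : D → Q} (hp : Function.Surjective p)
    (hrot : ∀ d, p (rot d) = p d ∨ p (rot d) = p (arc d)) :
    Module.finrank (ZMod 2) (LinearMap.ker (boundary arc p).mulVecLin) ≤
      numClasses fun d d' : D => d' = rot d ∨ d' = arc d := by
  set C := Quot fun d d' : D => d' = rot d ∨ d' = arc d
  have key : ∀ g : Q → ZMod 2, g ∈ LinearMap.ker (boundary arc p).mulVecLin →
      ∀ d d' : D, (Quot.mk _ d : C) = Quot.mk _ d' → g (p d) = g (p d') := by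
    intro g hg
    have harc' : ∀ d, g (p (arc d)) = g (p d) := by
      intro d
      have h := congrFun (LinearMap.mem_ker.1 hg) (Quot.mk _ d)
      rw [Matrix.mulVecLin_apply, boundary_mulVec harc hne] at h
      exact (CharTwo.add_eq_zero.1 h).symm
    intro d d' h
    refine congrArg (Quot.lift (fun d => g (p d)) ?_) h
    rintro x y (rfl | rfl)
    · rcases hrot x with h | h <;> simp [h, harc']
    · exact (harc' x).symm
  -- Evaluation at one representative dart of each component.
  let T : (Q → ZMod 2) →ₗ[ZMod 2] (C → ZMod 2) :=
    LinearMap.funLeft (ZMod 2) (ZMod 2) fun c : C => p c.out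
  have hinj : Function.Injective (T.domRestrict (LinearMap.ker (boundary arc p).mulVecLin)) := by
    rw [← LinearMap.ker_eq_bot, LinearMap.ker_eq_bot']
    rintro ⟨g, hg⟩ h0
    ext q
    obtain ⟨d, rfl⟩ := hp q
    have := congrFun h0 (Quot.mk _ d : C)
    exact (key g hg d (Quot.mk _ d : C).out (Quot.out_eq _).symm).trans this
  have h := LinearMap.finrank_le_finrank_of_injective hinj
  rwa [Module.finrank_fintype_fun_eq_card, ← Nat.card_eq_fintype_card] at h

lemma rank_boundary_ge {rot arc : D → D} (harc : ∀ d, arc (arc d) = d)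
    (hne : ∀ d, arc d ≠ d) {p : D → Q} (hp : Function.Surjective p)
    (hrot : ∀ d, p (rot d) = p d ∨ p (rot d) = p (arc d)) :
    Nat.card Q ≤ (boundary arc p).rank + numClasses fun d d' : D => d' = rot d ∨ d' = arc d := by
  have h1 := LinearMap.finrank_range_add_finrank_ker (boundary arc p).mulVecLin
  have h2 := finrank_ker_boundary_le harc hne hp hrot
  rw [Module.finrank_fintype_fun_eq_card, ← Nat.card_eq_fintype_card] at h1
  rw [Matrix.rank]
  omega

lemma vertex_sum_rot (rot : Equiv.Perm D) (h : D → ZMod 2)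
    (v : Quot fun d d' : D => d' = rot d) :
    ∑ d with Quot.mk _ d = v, h (rot d) = ∑ d with Quot.mk _ d = v, h d := by
  refine Finset.sum_equiv rot (fun d => ?_) fun _ _ => rfl
  have : (Quot.mk _ d : Quot fun d d' : D => d' = rot d) = Quot.mk _ (rot d) := Quot.sound rfl
  simp [this]

/-- The boundary of a face is a cycle: going around a vertex, every corner is met twice, once as the
face of `d` and once as the face of `rot d`, which is also that of `arc d`. -/
lemma boundary_transpose_comp (rot : Equiv.Perm D) {arc : D → D} (harc : ∀ d, arc (arc d) = d)
    (hne : ∀ d, arc d ≠ d) (g : (Quot fun d d' : D => d' = rot (arc d)) → ZMod 2) :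
    (boundary arc (Quot.mk fun d d' : D => d' = rot d))ᵀ *ᵥ
      (boundary arc (Quot.mk _) *ᵥ g) = 0 := by
  ext v
  rw [boundary, Matrix.transpose_mul, Matrix.transpose_transpose, ← Matrix.mulVec_mulVec,
    incidence_transpose_mulVec, incidence_mulVec]
  have h : ∀ d, g (Quot.mk _ (arc d)) = g (Quot.mk _ (rot d)) := fun d =>
    congrArg g (Quot.sound (by rw [harc]))
  simp only [Function.comp_apply, boundary_mulVec harc hne, h, Finset.sum_add_distrib]
  rw [vertex_sum_rot rot fun d => g (Quot.mk _ d)]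
  exact CharTwo.add_self_eq_zero _

/-- The ranks which occur in Euler's formula. -/
lemma euler_ranks (rot : Equiv.Perm D) {arc : D → D} (harc : ∀ d, arc (arc d) = d)
    (hne : ∀ d, arc d ≠ d) :
    numClasses (fun d d' => d' = rot d) +
        Module.finrank (ZMod 2) (LinearMap.ker
          (boundary arc (Quot.mk fun d d' : D => d' = rot d))ᵀ.mulVecLin) ≤
      numClasses (fun d d' => d' = arc d) +
        numClasses (fun d d' => d' = rot d ∨ d' = arc d) ∧
    numClasses (fun d d' => d' = rot (arc d)) ≤
      Module.finrank (ZMod 2) (LinearMap.range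
          (boundary arc (Quot.mk fun d d' : D => d' = rot (arc d))).mulVecLin) +
        numClasses (fun d d' => d' = rot d ∨ d' = arc d) := by
  constructor
  · have h1 := LinearMap.finrank_range_add_finrank_ker
      (boundary arc (Quot.mk fun d d' : D => d' = rot d))ᵀ.mulVecLin
    have h2 := rank_boundary_ge (rot := rot) harc hne
      (p := Quot.mk fun d d' : D => d' = rot d) Quot.mk_surjective
      fun d => Or.inl (Quot.sound (r := fun d d' : D => d' = rot d) rfl).symm
    rw [← Matrix.rank_transpose, Matrix.rank] at h2
    rw [Module.finrank_fintype_fun_eq_card, ← Nat.card_eq_fintype_card] at h1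
    have h3 : Nat.card (EdgeClass arc) = numClasses fun d d' => d' = arc d := rfl
    unfold numClasses at *
    omega
  · exact rank_boundary_ge (rot := rot) harc hne
      (p := Quot.mk fun d d' : D => d' = rot (arc d)) Quot.mk_surjective
      fun d => Or.inr (Quot.sound (by rw [harc])).symm

lemma range_boundary_le_ker (rot : Equiv.Perm D) {arc : D → D} (harc : ∀ d, arc (arc d) = d)
    (hne : ∀ d, arc d ≠ d) :
    LinearMap.range (boundary arc (Quot.mk fun d d' : D => d' = rot (arc d))).mulVecLin ≤
      LinearMap.ker (boundary arc (Quot.mk fun d d' : D => d' = rot d))ᵀ.mulVecLin := by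
  rintro _ ⟨g, rfl⟩
  exact boundary_transpose_comp rot harc hne g

/-- Every map on an oriented closed surface satisfies `V - E + F ≤ 2 C`. -/
lemma euler_le (rot : Equiv.Perm D) {arc : D → D} (harc : ∀ d, arc (arc d) = d)
    (hne : ∀ d, arc d ≠ d) :
    numClasses (fun d d' => d' = rot d) + numClasses (fun d d' => d' = rot (arc d)) ≤
      numClasses (fun d d' => d' = arc d) +
        2 * numClasses (fun d d' => d' = rot d ∨ d' = arc d) := by
  obtain ⟨h1, h2⟩ := euler_ranks rot harc hne
  have h3 := Submodule.finrank_mono (range_boundary_le_ker rot harc hne)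
  omega

/-- The faces of a planar map all of whose vertices have even valence have a checkerboard
colouring. -/
lemma exists_checkerboard (rot : Equiv.Perm D) {arc : D → D} (harc : ∀ d, arc (arc d) = d)
    (hne : ∀ d, arc d ≠ d) (hplanar : IsPlanarMap rot arc) {opp : D → D}
    (hopp : ∀ d, opp (opp d) = d) (hopp_ne : ∀ d, opp d ≠ d)
    (hopp_rot : ∀ d, (Quot.mk _ (opp d) : Quot fun d d' : D => d' = rot d) = Quot.mk _ d) :
    ∃ c : D → ZMod 2, (∀ d, c (arc d) = c d + 1) ∧ ∀ d, c (rot d) = c d + 1 := by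
  obtain ⟨h1, h2⟩ := euler_ranks rot harc hne
  have h3 := range_boundary_le_ker rot harc hne
  -- Equality in Euler's formula leaves no slack in the rank estimates: every cycle modulo two is a
  -- sum of face boundaries.
  have h4 := Submodule.eq_of_le_of_finrank_le h3 (by unfold IsPlanarMap at hplanar; omega)
  -- The sum of all edges is a cycle, since `opp` pairs off the darts at each vertex. A set of faces
  -- with this boundary is one colour class.
  have h5 : (fun _ => 1) ∈
      LinearMap.ker (boundary arc (Quot.mk fun d d' : D => d' = rot d))ᵀ.mulVecLin := by
    rw [LinearMap.mem_ker, Matrix.mulVecLin_apply]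
    ext v
    rw [boundary, Matrix.transpose_mul, Matrix.transpose_transpose, ← Matrix.mulVec_mulVec,
      incidence_transpose_mulVec, incidence_mulVec]
    refine Finset.sum_involution (fun d _ => opp d) ?_ ?_ ?_ ?_
    · exact fun _ _ => CharTwo.add_self_eq_zero _
    · exact fun d _ _ => hopp_ne d
    · intro d hd
      simpa [hopp_rot] using hd
    · exact fun d _ => hopp d
  rw [← h4] at h5
  obtain ⟨g, hg⟩ := h5
  have harc' : ∀ d, g (Quot.mk _ (arc d)) = g (Quot.mk _ d) + 1 := by
    intro d
    have := congrFun hg (Quot.mk _ d)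
    rw [Matrix.mulVecLin_apply, boundary_mulVec harc hne] at this
    rw [← this, ← add_assoc, CharTwo.add_self_eq_zero, zero_add]
  refine ⟨fun d => g (Quot.mk _ d), harc', fun d => ?_⟩
  rw [← harc']
  exact congrArg g (Quot.sound (by rw [harc])).symm

end Euler

/-! ## Circles and signs -/

lemma numClasses_congr {D D' : Type} {r : D → D → Prop} {r' : D' → D' → Prop} (e : D ≃ D')
    (h : ∀ x y, r x y ↔ r' (e x) (e y)) : numClasses r = numClasses r' :=
  Nat.card_congr (Quot.congr e h)

section Strands

variable {D : Type} {c : D → ZMod 2} {arc J J' : D → D}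

/-- Running along the strands of a split diagram, in the direction prescribed by a checkerboard
colouring `c`. -/
def strandPerm (harc : ∀ d, arc (arc d) = d) (hJ : ∀ d, J (J d) = d)
    (hca : ∀ d, c (arc d) = c d + 1) (hcJ : ∀ d, c (J d) = c d + 1) :
    Equiv.Perm {d // c d = 0} where
  toFun x := ⟨J (arc x), by rw [hcJ, hca, x.2]; decide⟩
  invFun x := ⟨arc (J x), by rw [hca, hcJ, x.2]; decide⟩
  left_inv x := by simp [hJ, harc]
  right_inv x := by simp [hJ, harc]

/-- Colours alternate along a circle, so every second dart has colour `0`, and these darts form one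
cycle. -/
lemma strandPerm_sameCycle (harc : ∀ d, arc (arc d) = d) (hJ : ∀ d, J (J d) = d)
    (hca : ∀ d, c (arc d) = c d + 1) (hcJ : ∀ d, c (J d) = c d + 1)
    (h1 : numClasses (fun d d' => d' = arc d ∨ d' = J d) = 1) (x y : {d // c d = 0}) :
    (strandPerm harc hJ hca hcJ).SameCycle x y := by
  have hz : ∀ a : ZMod 2, a ≠ 0 → a + 1 = 0 := by decide
  have hz' : ∀ a : ZMod 2, a = 0 → a + 1 ≠ 0 := by decide
  set π := strandPerm harc hJ hca hcJ
  -- A dart of the wrong colour is replaced by the dart joined to it, which lies on the same strand.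
  let norm : D → {d // c d = 0} := fun d =>
    if h : c d = 0 then ⟨d, h⟩ else ⟨J d, by rw [hcJ]; exact hz _ h⟩
  have hnorm : ∀ x : {d // c d = 0}, norm x = x := fun x => by simp [norm, x.2]
  have hnJ : ∀ d, norm (J d) = norm d := by
    intro d
    by_cases h : c d = 0
    · have h' : c (J d) ≠ 0 := by rw [hcJ]; exact hz' _ h
      simp [norm, h, h', hJ]
    · have h' : c (J d) = 0 := by rw [hcJ]; exact hz _ h
      simp [norm, h, h']
  have hna : ∀ d, c d = 0 → π (norm d) = norm (arc d) := by
    intro d h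
    have h' : c (arc d) ≠ 0 := by rw [hca]; exact hz' _ h
    simp [norm, h, h', π, strandPerm]
  have hq : ∀ d d' : D, d' = arc d ∨ d' = J d →
      (Quotient.mk (Equiv.Perm.SameCycle.setoid π) (norm d)) = Quotient.mk _ (norm d') := by
    rintro d d' (rfl | rfl)
    · refine Quotient.sound (?_ : π.SameCycle _ _)
      by_cases h : c d = 0
      · rw [← hna d h]
        exact Equiv.Perm.sameCycle_apply_right.2 (Equiv.Perm.SameCycle.refl _ _)
      · have h' : c (arc d) = 0 := by rw [hca]; exact hz _ h
        have := hna (arc d) h'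
        rw [harc] at this
        rw [← this]
        exact Equiv.Perm.sameCycle_apply_left.2 (Equiv.Perm.SameCycle.refl _ _)
    · rw [hnJ]
  obtain ⟨hs, -⟩ := Nat.card_eq_one_iff_unique.1 h1
  have h := congrArg (Quot.lift _ hq) (hs.elim (Quot.mk _ (x : D)) (Quot.mk _ (y : D)))
  have h' := Quotient.exact h
  rw [hnorm, hnorm] at h'
  exact h'

variable [Fintype D] [DecidableEq D]

lemma sign_strandPerm_of_numClasses_eq_one (harc : ∀ d, arc (arc d) = d) (hJ : ∀ d, J (J d) = d)
    (hca : ∀ d, c (arc d) = c d + 1) (hcJ : ∀ d, c (J d) = c d + 1)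
    [Nontrivial {d // c d = 0}]
    (h1 : numClasses (fun d d' => d' = arc d ∨ d' = J d) = 1) :
    Equiv.Perm.sign (strandPerm harc hJ hca hcJ) = -(-1) ^ Fintype.card {d // c d = 0} := by
  have hsc := strandPerm_sameCycle harc hJ hca hcJ h1
  set π := strandPerm harc hJ hca hcJ
  have hmove : ∀ x, π x ≠ x := by
    intro x hx
    obtain ⟨y, hy⟩ := exists_ne x
    exact hy ((hsc x y).eq_of_left hx).symm
  obtain ⟨x, -⟩ := exists_pair_ne {d // c d = 0}
  have hc : π.IsCycle := ⟨x, hmove x, fun y _ => hsc x y⟩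
  have hs : π.support = Finset.univ := by ext y; simp [hmove y]
  rw [hc.sign, hs, Finset.card_univ]

/-- The strand permutation applies `J` only to darts of nonzero colour, so the two joins need only
differ by a transposition there. -/
lemma sign_strandPerm_swap (harc : ∀ d, arc (arc d) = d) (hJ : ∀ d, J (J d) = d)
    (hJ' : ∀ d, J' (J' d) = d) (hca : ∀ d, c (arc d) = c d + 1) (hcJ : ∀ d, c (J d) = c d + 1)
    (hcJ' : ∀ d, c (J' d) = c d + 1) {a b : D} (ha : c a = 0) (hb : c b = 0) (hab : a ≠ b)
    (h : ∀ d, c d ≠ 0 → J' d = Equiv.swap a b (J d)) :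
    Equiv.Perm.sign (strandPerm harc hJ' hca hcJ') =
      -Equiv.Perm.sign (strandPerm harc hJ hca hcJ) := by
  have hz' : ∀ a : ZMod 2, a = 0 → a + 1 ≠ 0 := by decide
  have : strandPerm harc hJ' hca hcJ' =
      Equiv.swap ⟨a, ha⟩ ⟨b, hb⟩ * strandPerm harc hJ hca hcJ := by
    ext x
    have h' := h (arc x) (by rw [hca]; exact hz' _ x.2)
    simp only [strandPerm, Equiv.coe_fn_mk, Equiv.Perm.coe_mul, Function.comp_apply, h',
      Equiv.swap_apply_def, Subtype.ext_iff]
    split_ifs <;> rfl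
  rw [this, Equiv.Perm.sign_mul, Equiv.Perm.sign_swap (by simpa using hab), neg_one_mul]

/-- Changing the splitting at one crossing changes the sign. -/
lemma sign_strandPerm_flip (harc : ∀ d, arc (arc d) = d) (hJ : ∀ d, J (J d) = d)
    (hJ' : ∀ d, J' (J' d) = d) (hca : ∀ d, c (arc d) = c d + 1) (hcJ : ∀ d, c (J d) = c d + 1)
    (hcJ' : ∀ d, c (J' d) = c d + 1) {p : Fin 4 → D} (hp : Function.Injective p)
    (hcp : ∀ i, c (p (i + 1)) = c (p i) + 1) (hA : ∀ i, J (p i) = p (Splitting.A.partner i))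
    (hB : ∀ i, J' (p i) = p (Splitting.B.partner i))
    (hoff : ∀ d, (∀ i, d ≠ p i) → J' d = J d) :
    Equiv.Perm.sign (strandPerm harc hJ' hca hcJ') =
      -Equiv.Perm.sign (strandPerm harc hJ hca hcJ) := by
  have hz : ∀ a : ZMod 2, a ≠ 0 → a + 1 = 0 := by decide
  have hz' : ∀ a : ZMod 2, a = 0 → a + 1 ≠ 0 := by decide
  have hJp : ∀ d, (∀ i, d ≠ p i) → ∀ i, J d ≠ p i := by
    intro d hd i hi
    refine hd (Splitting.A.partner i) ?_
    rw [← hA, ← hi, hJ]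
  have h1 : c (p 1) = c (p 0) + 1 := hcp 0
  have h2 : c (p 2) = c (p 1) + 1 := hcp 1
  have h3 : c (p 3) = c (p 2) + 1 := hcp 2
  -- Opposite darts at a crossing share their colour. Seen from the other two darts, the `A`- and
  -- `B`-splittings differ by exchanging the two of colour `0`.
  have key : ∀ i : Fin 4, c (p i) = 0 → c (p (i + 2)) = 0 →
      (∀ j, c (p j) ≠ 0 → Splitting.B.partner j =
        Equiv.swap i (i + 2) (Splitting.A.partner j)) →
      Equiv.Perm.sign (strandPerm harc hJ' hca hcJ') =
        -Equiv.Perm.sign (strandPerm harc hJ hca hcJ) := by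
    intro i hi hi' hj
    refine sign_strandPerm_swap harc hJ hJ' hca hcJ hcJ' hi hi' ?_ ?_
    · intro h
      have hne : ∀ i : Fin 4, i ≠ i + 2 := by decide
      exact hne i (hp h)
    · intro d hd
      by_cases hdp : ∀ k, d ≠ p k
      · rw [hoff d hdp, Equiv.swap_apply_of_ne_of_ne (hJp d hdp _) (hJp d hdp _)]
      · push Not at hdp
        obtain ⟨k, rfl⟩ := hdp
        rw [hA, hB, hj k hd, hp.swap_apply]
  by_cases h0 : c (p 0) = 0
  · have e1 : c (p 1) ≠ 0 := by rw [h1]; exact hz' _ h0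
    have e2 : c (p 2) = 0 := by rw [h2]; exact hz _ e1
    refine key 0 h0 e2 fun j hj => ?_
    fin_cases j
    · exact absurd h0 hj
    · decide
    · exact absurd e2 hj
    · decide
  · have e1 : c (p 1) = 0 := by rw [h1]; exact hz _ h0
    have e2 : c (p 2) ≠ 0 := by rw [h2]; exact hz' _ e1
    have e3 : c (p 3) = 0 := by rw [h3]; exact hz _ e2
    refine key 1 e1 e3 fun j hj => ?_
    fin_cases j
    · decide
    · exact absurd e1 hj
    · decide
    · exact absurd e3 hj

end Strands

/-! ## States of ball tangle diagrams -/

/-- The sign of a splitting. -/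
def Splitting.sgn : Splitting → ℤˣ
  | .A => 1
  | .B => -1

lemma Splitting.partner_partner (s : Splitting) (i : Fin 4) : s.partner (s.partner i) = i := by
  revert s i; decide

/-- How the darts are joined when the crossings are split according to `σ`, and the outer vertex
is split like a crossing according to `s`. -/
def tangleJoin {X J : Type} (σ : X → Splitting) (s : Splitting) :
    Dart X J ⊕ Fin 4 → Dart X J ⊕ Fin 4
  | .inl (.inl (c, i)) => .inl (.inl (c, (σ c).partner i))
  | .inl (.inr (j, i)) => .inl (.inr (j, i + 1))
  | .inr i => .inr (s.partner i)

lemma tangleJoin_tangleJoin {X J : Type} (σ : X → Splitting) (s : Splitting)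
    (d : Dart X J ⊕ Fin 4) : tangleJoin σ s (tangleJoin σ s d) = d := by
  have h2 : ∀ i : Fin 2, i + 1 + 1 = i := by decide
  rcases d with (⟨c, i⟩ | ⟨j, i⟩) | i <;> simp [tangleJoin, Splitting.partner_partner, h2]

/-- The rotation of a ball tangle diagram as a permutation. -/
def tangleRotPerm (X J : Type) : Equiv.Perm (Dart X J ⊕ Fin 4) :=
  Equiv.sumCongr (Equiv.sumCongr (Equiv.prodCongr (Equiv.refl X) (Equiv.addRight 1))
    (Equiv.prodCongr (Equiv.refl J) (Equiv.addRight 1))) (Equiv.addRight 1)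

lemma coe_tangleRotPerm (X J : Type) : ⇑(tangleRotPerm X J) = tangleRot := by
  ext d
  rcases d with (⟨c, i⟩ | ⟨j, i⟩) | i <;> rfl

lemma colour_partner {D : Type} {c : D → ZMod 2} {p : Fin 4 → D}
    (hp : ∀ i, c (p (i + 1)) = c (p i) + 1) (s : Splitting) (i : Fin 4) :
    c (p (s.partner i)) = c (p i) + 1 := by
  have h0 := hp 0
  have h1 := hp 1
  have h2 := hp 2
  have h3 := hp 3
  have hz : ∀ a : ZMod 2, a + 1 + 1 = a := by decide
  have hz' : ∀ a b : ZMod 2, a = b + 1 → b = a + 1 := by decide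
  cases s <;> fin_cases i <;> first
    | exact h0 | exact h1 | exact h2 | exact h3
    | exact hz' _ _ h0 | exact hz' _ _ h1 | exact hz' _ _ h2 | exact hz' _ _ h3

lemma colour_tangleJoin {X J : Type} {c : Dart X J ⊕ Fin 4 → ZMod 2}
    (hc : ∀ d, c (tangleRot d) = c d + 1) (σ : X → Splitting) (s : Splitting)
    (d : Dart X J ⊕ Fin 4) : c (tangleJoin σ s d) = c d + 1 := by
  rcases d with (⟨x, i⟩ | ⟨j, i⟩) | i
  · exact colour_partner (c := c) (p := fun i => .inl (.inl (x, i))) (fun i => hc (.inl (.inl (x, i)))) _ i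
  · exact hc (.inl (.inr (j, i)))
  · exact colour_partner (c := c) (p := fun i => .inr i) (fun i => hc (.inr i)) _ i

/-- The darts opposite to each other at the vertices. -/
def tangleOpp {X J : Type} : Dart X J ⊕ Fin 4 → Dart X J ⊕ Fin 4
  | .inl (.inl (c, i)) => .inl (.inl (c, i + 2))
  | .inl (.inr (j, i)) => .inl (.inr (j, i + 1))
  | .inr i => .inr (i + 2)

lemma prod_update_apply {X M : Type} [Fintype X] [DecidableEq X] [CommMonoid M]
    (f : Splitting → M) (τ : X → Splitting) (j : X) (a : Splitting) :
    ∏ x, f (Function.update τ j a x) = f a * ∏ x ∈ Finset.univ \ {j}, f (τ x) := by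
  simp only [Function.apply_update (fun _ => f), Finset.prod_update_of_mem (Finset.mem_univ j)]

namespace BallTangleDiagram

variable (B : BallTangleDiagram)

/-- The number of circles of a split diagram; the outer vertex is split according to `s`. -/
def circles (σ : B.Crossing → Splitting) (s : Splitting) : ℕ :=
  numClasses fun d d' => d' = B.arc d ∨ d' = tangleJoin σ s d

lemma exists_colouring : ∃ c : Dart B.Crossing B.Mark ⊕ Fin 4 → ZMod 2,
    (∀ d, c (B.arc d) = c d + 1) ∧ ∀ d, c (tangleRot d) = c d + 1 := by
  have h := exists_checkerboard (tangleRotPerm B.Crossing B.Mark) B.arc_arc B.arc_ne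
    (by rw [coe_tangleRotPerm]; exact B.planar) (opp := tangleOpp)
  rw [coe_tangleRotPerm] at h
  apply h
  · have h4 : ∀ i : Fin 4, i + 2 + 2 = i := by decide
    have h2 : ∀ i : Fin 2, i + 1 + 1 = i := by decide
    rintro ((⟨c, i⟩ | ⟨j, i⟩) | i) <;> simp [tangleOpp, h4, h2]
  · have h4 : ∀ i : Fin 4, i + 2 ≠ i := by decide
    have h2 : ∀ i : Fin 2, i + 1 ≠ i := by decide
    rintro ((⟨c, i⟩ | ⟨j, i⟩) | i) <;> simp [tangleOpp]
  · have hrot : ∀ d : Dart B.Crossing B.Mark ⊕ Fin 4, (Quot.mk _ (tangleRot d) :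
        Quot fun d d' : Dart B.Crossing B.Mark ⊕ Fin 4 => d' = tangleRot d) = Quot.mk _ d :=
      fun d => (Quot.sound (r := fun d d' => d' = tangleRot d) rfl).symm
    have h4 : ∀ i : Fin 4, i + 2 = i + 1 + 1 := by decide
    rintro ((⟨c, i⟩ | ⟨j, i⟩) | i)
    · rw [← hrot (.inl (.inl (c, i))), ← hrot (tangleRot _)]
      simp [tangleOpp, tangleRot, h4]
    · exact hrot (.inl (.inr (j, i)))
    · rw [← hrot (.inr i), ← hrot (tangleRot _)]
      simp [tangleOpp, tangleRot, h4]

/-- The parity of the number of `B`-type splittings is the same in all states with one circle, if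
the splitting of the outer vertex is counted. -/
lemma exists_prod_sgn_eq : ∃ κ : ℤˣ, ∀ (σ : B.Crossing → Splitting) (s : Splitting),
    B.circles σ s = 1 → (∏ x, (σ x).sgn) * s.sgn = κ := by
  classical
  obtain ⟨c, hca, hcr⟩ := B.exists_colouring
  let S : (B.Crossing → Splitting) → Splitting → ℤˣ := fun σ s =>
    Equiv.Perm.sign (strandPerm B.arc_arc (tangleJoin_tangleJoin σ s) hca
      (colour_tangleJoin hcr σ s))
  have houter : ∀ σ, S σ .B = -S σ .A := by
    intro σ
    refine sign_strandPerm_flip _ _ _ _ _ _ (p := fun i => .inr i) Sum.inr_injective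
      (fun i => hcr (.inr i)) (fun _ => rfl) (fun _ => rfl) ?_
    rintro ((⟨x, i⟩ | ⟨j, i⟩) | i) hd
    · rfl
    · rfl
    · exact absurd rfl (hd i)
  have hinner : ∀ σ s x, S (Function.update σ x .B) s = -S (Function.update σ x .A) s := by
    intro σ s x
    refine sign_strandPerm_flip _ _ _ _ _ _ (p := fun i => .inl (.inl (x, i)))
      (fun i j h => by simpa using h) (fun i => hcr (.inl (.inl (x, i)))) (fun _ => ?_)
      (fun _ => ?_) ?_
    · simp [tangleJoin]
    · simp [tangleJoin]
    · rintro ((⟨y, i⟩ | ⟨j, i⟩) | i) hd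
      · have : y ≠ x := by rintro rfl; exact hd i rfl
        simp [tangleJoin, this]
      · rfl
      · rfl
  -- In `T` both factors change sign with each change of splitting, so `T` is constant over all
  -- states.
  let T : (B.Crossing → Splitting) → Splitting → ℤˣ := fun σ s =>
    (∏ x, (σ x).sgn) * s.sgn * S σ s
  have hT1 : ∀ σ s, T σ s = T σ .A := by
    intro σ s
    cases s
    · rfl
    · simp [T, houter, Splitting.sgn]
  have hT2 : ∀ σ s x a, T (Function.update σ x a) s = T σ s := by
    intro σ s x
    have hBA : T (Function.update σ x .B) s = T (Function.update σ x .A) s := by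
      simp only [T, hinner, prod_update_apply]
      simp [Splitting.sgn]
    have hall : ∀ a, T (Function.update σ x a) s = T (Function.update σ x .A) s := by
      rintro (_ | _)
      · rfl
      · exact hBA
    intro a
    rw [hall a, ← hall (σ x), Function.update_eq_self]
  have hT3 : ∀ σ, T σ .A = T (fun _ => .A) .A := by
    intro σ
    have : ∀ t : Finset B.Crossing, T (t.piecewise σ fun _ => .A) .A = T (fun _ => .A) .A := by
      intro t
      induction t using Finset.induction with
      | empty => simp
      | insert x t _ ih => rw [Finset.piecewise_insert, hT2, ih]
    simpa using this Finset.univ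
  -- The outer vertex alone supplies two darts of colour `0`, so a single cycle through all such
  -- darts is not the identity.
  have : Nontrivial {d // c d = 0} := by
    have h1 : c (.inr 1) = c (.inr 0) + 1 := hcr (.inr 0)
    have h2 : c (.inr 2) = c (.inr 1) + 1 := hcr (.inr 1)
    have h3 : c (.inr 3) = c (.inr 2) + 1 := hcr (.inr 2)
    have hz : ∀ a : ZMod 2, a ≠ 0 → a + 1 = 0 := by decide
    have hz' : ∀ a : ZMod 2, a = 0 → a + 1 + 1 = 0 := by decide
    by_cases h0 : c (.inr 0) = 0
    · exact ⟨⟨.inr 0, h0⟩, ⟨.inr 2, by rw [h2, h1]; exact hz' _ h0⟩, by simp⟩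
    · have h1' : c (.inr 1) = 0 := by rw [h1]; exact hz _ h0
      exact ⟨⟨.inr 1, h1'⟩, ⟨.inr 3, by rw [h3, h2]; exact hz' _ h1'⟩, by simp⟩
  refine ⟨T (fun _ => .A) .A * (-(-1) ^ Fintype.card {d // c d = 0}), fun σ s h => ?_⟩
  have hS : S σ s = -(-1) ^ Fintype.card {d // c d = 0} :=
    sign_strandPerm_of_numClasses_eq_one _ _ _ _ h
  rw [← hS, ← hT3 σ, ← hT1 σ s]
  simp only [T]
  rw [mul_assoc _ (S σ s), Int.units_mul_self, mul_one]

end BallTangleDiagram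

/-! ## The bracket at an eighth root of unity -/

/-- The value `exp (i π / 4)` of the variable `A`. -/
def rootA : ℂ := Complex.exp (Complex.I * Real.pi / 4)

lemma rootA_sq : rootA ^ 2 = Complex.I := by
  have h : ((2 : ℕ) : ℂ) * (Complex.I * Real.pi / 4) = Real.pi / 2 * Complex.I := by
    push_cast
    ring
  rw [rootA, ← Complex.exp_nat_mul, h, Complex.exp_pi_div_two_mul_I]

lemma rootA_ne_zero : rootA ≠ 0 := Complex.exp_ne_zero _

lemma rootA_inv : rootA⁻¹ = rootA * -Complex.I := by
  refine inv_eq_of_mul_eq_one_right ?_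
  linear_combination (-Complex.I) * rootA_sq - Complex.I_mul_I

lemma rootA_pow_eight : rootA ^ 8 = 1 := by
  have : rootA ^ 8 = (rootA ^ 2) ^ 4 := by ring
  rw [this, rootA_sq, Complex.I_pow_four]

lemma loop_value : -rootA ^ 2 - rootA⁻¹ ^ 2 = 0 := by
  rw [rootA_inv, mul_pow, neg_sq, Complex.I_sq, rootA_sq]
  ring

/-- The weight of a splitting in the Kauffman bracket. -/
def Splitting.weight : Splitting → ℂ
  | .A => rootA
  | .B => rootA⁻¹

/-- The weight of a splitting, relative to the weight of an `A`-type splitting. -/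
def Splitting.relWeight : Splitting → ℂ
  | .A => 1
  | .B => -Complex.I

lemma Splitting.weight_eq (s : Splitting) : s.weight = rootA * s.relWeight := by
  cases s
  · simp [weight, relWeight]
  · exact rootA_inv

lemma Splitting.relWeight_sq (s : Splitting) : s.relWeight ^ 2 = ((s.sgn : ℤ) : ℂ) := by
  cases s <;> simp [relWeight, sgn]

lemma prod_weight {X : Type} [Fintype X] (σ : X → Splitting) :
    rootA ^ (Finset.univ.filter fun c => σ c = .A).card *
      rootA⁻¹ ^ (Finset.univ.filter fun c => σ c = .B).card = ∏ x, (σ x).weight := by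
  have h : ∀ s : Splitting, s.weight = (if s = .A then rootA else 1) *
      if s = .B then rootA⁻¹ else 1 := by
    rintro (_ | _) <;> simp [Splitting.weight]
  simp only [h]
  rw [Finset.prod_mul_distrib]
  simp [Finset.prod_ite]

namespace BallTangleDiagram

variable (B : BallTangleDiagram)

/-- The two darts of the marked point on an outer arc are joined to each other, exactly as a
splitting of the outer vertex would join these end points. -/
lemma numCircles_close {g : Fin 4 ≃ Fin 2 × Fin 2} {s : Splitting}
    (hg : ∀ i, g (s.partner i) = ((g i).1, (g i).2 + 1)) (σ : B.Crossing → Splitting) :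
    (B.close g).numCircles σ = B.circles σ s := by
  have hjoin : ∀ d, (B.close g).join σ (closeDarts B.Crossing B.Mark g d) =
      closeDarts B.Crossing B.Mark g (tangleJoin σ s d) := by
    rintro ((⟨x, i⟩ | ⟨j, i⟩) | i)
    · rfl
    · rfl
    · simp [closeDarts, tangleJoin, hg, LinkCode.join]
      rfl
  refine (numClasses_congr (closeDarts B.Crossing B.Mark g) fun x y => ?_).symm
  rw [hjoin]
  simp [close]

/-- The Kauffman bracket of a closure, as a sum over the states with one circle. -/
def stateSum (s : Splitting) : ℂ :=
  ∑ σ : B.Crossing → Splitting, if B.circles σ s = 1 then ∏ x, (σ x).weight else 0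

lemma circles_pos (σ : B.Crossing → Splitting) (s : Splitting) : 0 < B.circles σ s :=
  Nat.card_pos_iff.2 ⟨⟨Quot.mk _ (.inr 0)⟩, inferInstance⟩

lemma bracket_close {g : Fin 4 ≃ Fin 2 × Fin 2} {s : Splitting}
    (hg : ∀ i, g (s.partner i) = ((g i).1, (g i).2 + 1)) :
    (B.close g).bracket rootA = B.stateSum s := by
  change ∑ σ : B.Crossing → Splitting,
    rootA ^ (Finset.univ.filter fun c : B.Crossing => σ c = .A).card *
      rootA⁻¹ ^ (Finset.univ.filter fun c : B.Crossing => σ c = .B).card *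
        (-rootA ^ 2 - rootA⁻¹ ^ 2) ^ ((B.close g).numCircles σ - 1) = _
  refine Finset.sum_congr rfl fun σ _ => ?_
  rw [loop_value, B.numCircles_close hg, prod_weight]
  have := B.circles_pos σ s
  -- The loop factor is now a power of `0`, with `0 ^ 0 = 1` for one circle.
  by_cases h : B.circles σ s = 1
  · rw [if_pos h, h]
    simp
  · rw [if_neg h, zero_pow (by omega), mul_zero]

lemma bracket_numerator : B.numerator.bracket rootA = B.stateSum .A :=
  B.bracket_close (by decide)

lemma bracket_denominator : B.denominator.bracket rootA = B.stateSum .B :=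
  B.bracket_close (by decide)

lemma mem_krebesSet {M : Matrix (Fin 2) (Fin 1) ℤ} : M ∈ B.krebesSet ↔
    ∃ z : ℂ, z ^ 8 = 1 ∧ (M 0 0 : ℂ) = z * B.stateSum .A ∧
      (M 1 0 : ℂ) = Complex.I * z * B.stateSum .B := by
  rw [← bracket_numerator, ← bracket_denominator]
  refine exists_congr fun z => and_congr_right fun _ => ?_
  rw [← Matrix.ext_iff, Fin.forall_fin_two]
  simp [rootA]

/-- For every contributing state the product of relative weights has square `κ * s.sgn`, so it
equals `u` or `-u`. -/
lemma stateSum_mem {κ : ℤˣ} (hκ : ∀ (σ : B.Crossing → Splitting) (s : Splitting),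
    B.circles σ s = 1 → (∏ x, (σ x).sgn) * s.sgn = κ) {s : Splitting} {u : ℂ}
    (hu : u ^ 2 = ((κ * s.sgn : ℤˣ) : ℤ)) :
    ∃ m : ℤ, B.stateSum s = m * (rootA ^ Fintype.card B.Crossing * u) := by
  have : B.stateSum s ∈ AddSubgroup.zmultiples (rootA ^ Fintype.card B.Crossing * u) := by
    refine AddSubgroup.sum_mem _ fun σ _ => ?_
    split_ifs with h
    · have hσ := hκ σ s h
      have h1 : (∏ x, (σ x).relWeight) ^ 2 = u ^ 2 := by
        rw [hu, ← hσ, mul_assoc, Int.units_mul_self, mul_one, ← Finset.prod_pow]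
        simp [Splitting.relWeight_sq]
      simp only [Splitting.weight_eq, Finset.prod_mul_distrib, Finset.prod_const, Finset.card_univ]
      rcases sq_eq_sq_iff_eq_or_eq_neg.1 h1 with h2 | h2
      · rw [h2]
        exact AddSubgroup.mem_zmultiples _
      · rw [h2, mul_neg]
        exact neg_mem (AddSubgroup.mem_zmultiples _)
    · exact zero_mem _
  obtain ⟨m, hm⟩ := AddSubgroup.mem_zmultiples_iff.1 this
  exact ⟨m, by rw [← hm, zsmul_eq_mul]⟩

lemma krebesSet_nonempty : B.krebesSet.Nonempty := by
  obtain ⟨κ, hκ⟩ := B.exists_prod_sgn_eq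
  have hA := pow_ne_zero (Fintype.card B.Crossing) rootA_ne_zero
  have hA8 : (rootA ^ Fintype.card B.Crossing) ^ 8 = 1 := by
    rw [← pow_mul, mul_comm, pow_mul, rootA_pow_eight, one_pow]
  have hI8 : Complex.I ^ 8 = 1 := by
    rw [show (8 : ℕ) = 4 * 2 from rfl, pow_mul, Complex.I_pow_four, one_pow]
  -- The square roots `u` needed for the two closures are `1, i` or `i, 1`; `z` is chosen to cancel
  -- the factor in the numerator, and the extra `i` repairs the denominator.
  rcases Int.units_eq_one_or κ with rfl | rfl
  · obtain ⟨m, hm⟩ := B.stateSum_mem hκ (s := .A) (u := 1) (by simp [Splitting.sgn])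
    obtain ⟨n, hn⟩ := B.stateSum_mem hκ (s := .B) (u := Complex.I) (by simp [Splitting.sgn])
    refine ⟨!![m; -n], B.mem_krebesSet.2 ⟨(rootA ^ Fintype.card B.Crossing)⁻¹, ?_, ?_, ?_⟩⟩
    · rw [inv_pow, hA8, inv_one]
    · rw [hm]
      simp
      field_simp
    · rw [hn]
      simp
      field_simp
      rw [Complex.I_sq]
      ring
  · obtain ⟨m, hm⟩ := B.stateSum_mem hκ (s := .A) (u := Complex.I) (by simp [Splitting.sgn])
    obtain ⟨n, hn⟩ := B.stateSum_mem hκ (s := .B) (u := 1) (by simp [Splitting.sgn])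
    refine ⟨!![m; n], B.mem_krebesSet.2
      ⟨(rootA ^ Fintype.card B.Crossing * Complex.I)⁻¹, ?_, ?_, ?_⟩⟩
    · rw [inv_pow, mul_pow, hA8, hI8, one_mul, inv_one]
    · rw [hm]
      simp
      field_simp
      rw [Complex.I_sq]
      ring
    · rw [hn]
      simp
      field_simp
      rw [Complex.I_sq]
      ring

end BallTangleDiagram

/-! ### Uniqueness up to sign and well-definedness -/

lemma eq_or_eq_neg_of_eq_mul {w : ℂ} (hw : w ^ 8 = 1) {a b : ℤ} (ha : a ≠ 0)
    (h : (b : ℂ) = w * a) : w = 1 ∨ w = -1 := by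
  have hn : ‖w‖ = 1 := Complex.norm_eq_one_of_pow_eq_one hw (by norm_num)
  have h1 := congrArg norm h
  rw [norm_mul, hn, one_mul, Complex.norm_intCast, Complex.norm_intCast] at h1
  have ha' : (a : ℂ) ≠ 0 := by exact_mod_cast ha
  have h2 : |b| = |a| := by exact_mod_cast h1
  rcases abs_eq_abs.1 h2 with rfl | rfl
  · left
    exact (mul_right_cancel₀ ha' (by rw [← h, one_mul])).symm
  · right
    refine mul_right_cancel₀ ha' (by rw [← h]; push_cast; ring)

namespace BallTangleDiagram

variable (B : BallTangleDiagram)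

lemma neg_mem_krebesSet {M : Matrix (Fin 2) (Fin 1) ℤ} (hM : M ∈ B.krebesSet) :
    -M ∈ B.krebesSet := by
  obtain ⟨z, hz, h0, h1⟩ := B.mem_krebesSet.1 hM
  refine B.mem_krebesSet.2 ⟨-z, by rw [Even.neg_pow (by decide), hz], ?_, ?_⟩
  · simp [h0]
  · simp [h1]

lemma eq_or_eq_neg_of_mem_krebesSet {M N : Matrix (Fin 2) (Fin 1) ℤ} (hM : M ∈ B.krebesSet)
    (hN : N ∈ B.krebesSet) : N = M ∨ N = -M := by
  obtain ⟨z, hz, h0, h1⟩ := B.mem_krebesSet.1 hM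
  obtain ⟨w, hw, k0, k1⟩ := B.mem_krebesSet.1 hN
  have hz0 : z ≠ 0 := by
    rintro rfl
    norm_num at hz
  have hu : (w / z) ^ 8 = 1 := by rw [div_pow, hz, hw, div_one]
  have e0 : (N 0 0 : ℂ) = w / z * M 0 0 := by rw [h0, k0]; field_simp
  have e1 : (N 1 0 : ℂ) = w / z * M 1 0 := by rw [h1, k1]; field_simp
  have hext : ∀ P Q : Matrix (Fin 2) (Fin 1) ℤ, (P 0 0 : ℂ) = Q 0 0 → (P 1 0 : ℂ) = Q 1 0 →
      P = Q := by
    intro P Q hp hq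
    ext i j
    fin_cases j
    fin_cases i
    · exact_mod_cast hp
    · exact_mod_cast hq
  by_cases hM0 : M = 0
  · subst hM0
    left
    exact hext _ _ (by simpa using e0) (by simpa using e1)
  -- One nonzero entry determines the ratio of the two roots of unity; it then applies to both
  -- entries.
  have hu' : w / z = 1 ∨ w / z = -1 := by
    by_cases m0 : M 0 0 = 0
    · have m1 : M 1 0 ≠ 0 := by
        intro m1
        exact hM0 (hext _ _ (by simp [m0]) (by simp [m1]))
      exact eq_or_eq_neg_of_eq_mul hu m1 e1
    · exact eq_or_eq_neg_of_eq_mul hu m0 e0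
  rcases hu' with h | h
  · left
    exact hext _ _ (by rw [e0, h, one_mul]) (by rw [e1, h, one_mul])
  · right
    exact hext _ _ (by rw [e0, h]; simp) (by rw [e1, h]; simp)

lemma orbit_eq_krebesSet {M : Matrix (Fin 2) (Fin 1) ℤ} (hM : M ∈ B.krebesSet) :
    MulAction.orbitRel.Quotient.orbit (Quotient.mk _ M : PM 2 1) = B.krebesSet := by
  change MulAction.orbit ℤˣ M = _
  ext N
  constructor
  · rintro ⟨u, rfl⟩
    rcases Int.units_eq_one_or u with rfl | rfl
    · simpa using hM
    · simpa [Units.smul_def] using B.neg_mem_krebesSet hM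
  · intro hN
    rcases B.eq_or_eq_neg_of_mem_krebesSet hM hN with rfl | rfl
    · exact MulAction.mem_orbit_self _
    · exact ⟨-1, by simp [Units.smul_def]⟩

end BallTangleDiagram

/-- Krebes' invariant is well defined. -/
lemma exists_isKrebesInvariant : ∃ f : BallTangleDiagram → PM 2 1, IsKrebesInvariant f :=
  ⟨fun B => Quotient.mk _ B.krebesSet_nonempty.some,
    fun B => B.orbit_eq_krebesSet B.krebesSet_nonempty.some_mem⟩

lemma surjective_of_forall_mem_krebesSet {f : BallTangleDiagram → PM 2 1}
    (hf : IsKrebesInvariant f)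
    (h : ∀ M : Matrix (Fin 2) (Fin 1) ℤ, ∃ B : BallTangleDiagram, M ∈ B.krebesSet) :
    Function.Surjective f := by
  intro q
  induction q using Quotient.inductionOn with
  | h M =>
    obtain ⟨B, hB⟩ := h M
    refine ⟨B, ?_⟩
    apply MulAction.orbitRel.Quotient.orbit_injective
    rw [hf B, ← B.orbit_eq_krebesSet hB]

/-! ## Gluing a ball tangle diagram into a diagram in an annulus -/

lemma card_le_numClasses {M Q : Type} [Finite M] {r : M → M → Prop} (f : M → Q)
    (hf : Function.Surjective f) (h : ∀ x y, r x y → f x = f y) : Nat.card Q ≤ numClasses r :=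
  Nat.card_le_card_of_surjective (Quot.lift f h) fun q => by
    obtain ⟨m, rfl⟩ := hf q
    exact ⟨Quot.mk _ m, rfl⟩

lemma numClasses_le_card {M Q : Type} [Finite Q] {r : M → M → Prop} (f : Q → Quot r)
    (hf : ∀ m, ∃ q, f q = Quot.mk r m) : numClasses r ≤ Nat.card Q :=
  Nat.card_le_card_of_surjective f fun q => by
    induction q using Quot.inductionOn with
    | h m => exact hf m

/-- Used to shrink the strands of an annulus diagram back to the old end points without changing the
number of circles. -/
lemma numClasses_eq_of_retract {D M : Type} {r : D → D → Prop} {r' : M → M → Prop}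
    (ι : D → M) (ρ : M → D)
    (hι : ∀ x y, r x y → Quot.mk r' (ι x) = Quot.mk r' (ι y))
    (hρ : ∀ x y, r' x y → Quot.mk r (ρ x) = Quot.mk r (ρ y))
    (hρι : ∀ x, ρ (ι x) = x) (hιρ : ∀ m, Quot.mk r' (ι (ρ m)) = Quot.mk r' m) :
    numClasses r' = numClasses r :=
  Nat.card_congr
    { toFun := Quot.lift (fun m => Quot.mk r (ρ m)) hρ
      invFun := Quot.lift (fun d => Quot.mk r' (ι d)) hι
      left_inv := by rintro ⟨m⟩; exact hιρ m
      right_inv := by rintro ⟨d⟩; exact congrArg _ (hρι d) }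

section Gluing

variable {k n : ℕ}

/-- The rotation at `k` new crossings and at the outer vertex. -/
def localRot : (Fin k × Fin 4) ⊕ Fin 4 → (Fin k × Fin 4) ⊕ Fin 4 :=
  Sum.map (fun p => (p.1, p.2 + 1)) (· + 1)

/-- How the darts are joined at `k` new crossings and at the outer vertex. -/
def localJoin (t : Fin k → Splitting) (s : Splitting) :
    (Fin k × Fin 4) ⊕ Fin 4 → (Fin k × Fin 4) ⊕ Fin 4 :=
  Sum.map (fun p => (p.1, (t p.1).partner p.2)) s.partner

/-- The darts at the new crossings and at the outer vertex. -/
def localDart {X J : Type} : (Fin k × Fin 4) ⊕ Fin 4 → Dart (X ⊕ Fin k) J ⊕ Fin 4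
  | .inl (a, i) => .inl (.inl (.inr a, i))
  | .inr i => .inr i

/-- The four old end points and the `n` new darts. -/
def annulusDart {D : Type} : Fin 4 ⊕ Fin n → (D ⊕ Fin 4) ⊕ Fin n
  | .inl i => .inl (.inr i)
  | .inr j => .inr j

lemma forall_annulus {D : Type} {P : (D ⊕ Fin 4) ⊕ Fin n → Prop} (h1 : ∀ d, P (.inl (.inl d)))
    (h2 : ∀ x, P (annulusDart x)) (m) : P m := by
  rcases m with (d | i) | j
  · exact h1 d
  · exact h2 (.inl i)
  · exact h2 (.inr j)

/-- The darts of the glued diagram: `w` tells which darts at the new crossings and at the new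
outer vertex the old end points become. -/
def glueEquiv (w : Fin 4 ⊕ Fin n ≃ (Fin k × Fin 4) ⊕ Fin 4) (X J : Type) :
    (Dart X J ⊕ Fin 4) ⊕ Fin n ≃ Dart (X ⊕ Fin k) J ⊕ Fin 4 where
  toFun
    | .inl (.inl (.inl (c, i))) => .inl (.inl (.inl c, i))
    | .inl (.inl (.inr p)) => .inl (.inr p)
    | .inl (.inr i) => localDart (w (.inl i))
    | .inr j => localDart (w (.inr j))
  invFun
    | .inl (.inl (.inl c, i)) => .inl (.inl (.inl (c, i)))
    | .inl (.inl (.inr a, i)) => annulusDart (w.symm (.inl (a, i)))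
    | .inl (.inr p) => .inl (.inl (.inr p))
    | .inr i => annulusDart (w.symm (.inr i))
  left_inv := by
    rintro (((⟨c, i⟩ | p) | i) | j)
    · rfl
    · rfl
    · generalize h : w (.inl i) = y
      have h' : w.symm y = .inl i := by rw [← h, w.symm_apply_apply]
      rcases y with ⟨a, i'⟩ | i' <;> simp [localDart, h, h', annulusDart]
    · generalize h : w (.inr j) = y
      have h' : w.symm y = .inr j := by rw [← h, w.symm_apply_apply]
      rcases y with ⟨a, i'⟩ | i' <;> simp [localDart, h, h', annulusDart]
  right_inv := by
    rintro ((⟨c | a, i⟩ | p) | i)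
    · rfl
    · generalize h : w.symm (.inl (a, i)) = y
      have h' : w y = .inl (a, i) := by rw [← h, w.apply_symm_apply]
      rcases y with y | y <;> simp [localDart, h, h', annulusDart]
    · rfl
    · generalize h : w.symm (.inr i) = y
      have h' : w y = .inr i := by rw [← h, w.apply_symm_apply]
      rcases y with y | y <;> simp [localDart, h, h', annulusDart]

variable (w : Fin 4 ⊕ Fin n ≃ (Fin k × Fin 4) ⊕ Fin 4) {X J : Type}

lemma glueEquiv_annulusDart (x : Fin 4 ⊕ Fin n) :
    glueEquiv w X J (annulusDart x) = localDart (w x) := by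
  rcases x with i | j <;> rfl

/-- The rotation of the glued diagram. -/
def glueRot : Equiv.Perm ((Dart X J ⊕ Fin 4) ⊕ Fin n) :=
  ((glueEquiv w X J).trans (tangleRotPerm (X ⊕ Fin k) J)).trans (glueEquiv w X J).symm

lemma glueRot_inl (d : Dart X J) : glueRot w (.inl (.inl d)) = .inl (tangleRot (.inl d)) := by
  rcases d with ⟨c, i⟩ | p <;> rfl

lemma glueRot_annulusDart (x : Fin 4 ⊕ Fin n) :
    glueRot w (annulusDart x : (Dart X J ⊕ Fin 4) ⊕ Fin n) =
      annulusDart (w.symm (localRot (w x))) := by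
  simp only [glueRot, Equiv.trans_apply, Equiv.symm_apply_eq, glueEquiv_annulusDart,
    Equiv.apply_symm_apply]
  rcases w x with ⟨a, i⟩ | i <;> rfl

/-- How the darts of the glued diagram are joined in a state. -/
def glueJoin (σ : X → Splitting) (t : Fin k → Splitting) (s : Splitting)
    (m : (Dart X J ⊕ Fin 4) ⊕ Fin n) : (Dart X J ⊕ Fin 4) ⊕ Fin n :=
  (glueEquiv w X J).symm (tangleJoin (Sum.elim σ t) s (glueEquiv w X J m))

lemma glueJoin_inl (σ : X → Splitting) (t : Fin k → Splitting) (s s' : Splitting) (d : Dart X J) :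
    glueJoin w σ t s (.inl (.inl d)) = .inl (tangleJoin σ s' (.inl d)) := by
  rcases d with ⟨c, i⟩ | p <;> rfl

lemma glueJoin_annulusDart (σ : X → Splitting) (t : Fin k → Splitting) (s : Splitting)
    (x : Fin 4 ⊕ Fin n) : glueJoin w σ t s (annulusDart x : (Dart X J ⊕ Fin 4) ⊕ Fin n) =
      annulusDart (w.symm (localJoin t s (w x))) := by
  simp only [glueJoin, Equiv.symm_apply_eq, glueEquiv_annulusDart, Equiv.apply_symm_apply]
  rcases w x with ⟨a, i⟩ | i <;> rfl

/-- The new arcs; nothing happens to the old end points. -/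
def annulusArc : Fin 4 ⊕ Fin n → Fin 4 ⊕ Fin n := Sum.map id Fin.rev

/-- A diagram in an annulus, with `a` crossings and `2 * (a + b)` darts, which creates `b` new
faces when a disk diagram is glued in: `v` gives the vertex of every dart, with `none` the outer
vertex, and `f` tells to which old or new face a new dart belongs. -/
structure IsPlanarGluing (a b : ℕ) (v : Fin 4 ⊕ Fin n → Option (Fin a))
    (f : Fin n → Fin 4 ⊕ Fin b) : Prop where
  card : n = 2 * (a + b)
  vertex_rot : ∀ x, v (w.symm (localRot (w x))) = v x
  vertex_surj : ∀ y, ∃ x, v x = y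
  face_old : ∀ i, Sum.elim Sum.inl f (w.symm (localRot (w (.inl i)))) = .inl (i + 1)
  face_new : ∀ j, Sum.elim Sum.inl f (w.symm (localRot (w (.inr j)))) = f j.rev
  face_surj : ∀ y, ∃ j, f j = .inr y
  connected : ∀ x, ∃ l m : Fin 4, (fun y => w.symm (localRot (w y)))^[m]
    (annulusArc ((fun y => w.symm (localRot (w y)))^[l] x)) = .inl 0

/-- The strands of the split annulus diagram join the old end points like the splitting `s'` of
the outer vertex of the disk diagram, and every new dart lies on one of them: `ρ` gives an old end
point on the strand of a new dart. -/
structure SplitsTo (w : Fin 4 ⊕ Fin n ≃ (Fin k × Fin 4) ⊕ Fin 4) (t : Fin k → Splitting)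
    (s s' : Splitting) (ρ : Fin n → Fin 4) : Prop where
  old : ∀ i, ∃ l : Fin (n + 4), (fun y => w.symm (localJoin t s (w (annulusArc y))))^[l]
    (w.symm (localJoin t s (w (.inl i)))) = .inl (s'.partner i)
  new : ∀ j, ∃ l : Fin (n + 4), (fun y => w.symm (localJoin t s (w (annulusArc y))))^[l]
    (.inr j) = .inl (ρ j)
  join : ∀ x, Sum.elim id ρ (w.symm (localJoin t s (w x))) = Sum.elim id ρ x ∨
    Sum.elim id ρ (w.symm (localJoin t s (w x))) = s'.partner (Sum.elim id ρ x)
  arc : ∀ j, ρ j.rev = ρ j ∨ ρ j.rev = s'.partner (ρ j)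

/-- The split annulus diagram contains a circle, formed by the new darts `j` with `δ j = true`. -/
structure HasCircle (w : Fin 4 ⊕ Fin n ≃ (Fin k × Fin 4) ⊕ Fin 4) (t : Fin k → Splitting)
    (s : Splitting) (δ : Fin n → Bool) : Prop where
  join : ∀ x, Sum.elim (fun _ => false) δ (w.symm (localJoin t s (w x))) =
    Sum.elim (fun _ => false) δ x
  arc : ∀ j, δ j.rev = δ j
  nonempty : ∃ j, δ j = true

variable {w}

/-! ### Planarity of glued diagrams -/

section Planarity

variable {arc : Dart X J ⊕ Fin 4 → Dart X J ⊕ Fin 4}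

/-- The arcs of the glued diagram. -/
abbrev glueArc (n : ℕ) (arc : Dart X J ⊕ Fin 4 → Dart X J ⊕ Fin 4) :
    (Dart X J ⊕ Fin 4) ⊕ Fin n → (Dart X J ⊕ Fin 4) ⊕ Fin n := Sum.map arc Fin.rev

lemma glueArc_glueArc (harc : ∀ d, arc (arc d) = d) (m : (Dart X J ⊕ Fin 4) ⊕ Fin n) :
    glueArc n arc (glueArc n arc m) = m := by
  rcases m with d | j <;> simp [harc]

lemma glueArc_ne (hn : Even n) (hne : ∀ d, arc d ≠ d) (m : (Dart X J ⊕ Fin 4) ⊕ Fin n) :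
    glueArc n arc m ≠ m := by
  rcases m with d | j
  · simp [hne]
  · obtain ⟨l, rfl⟩ := hn
    simp only [Sum.map_inr, ne_eq, Sum.inr.injEq, Fin.ext_iff, Fin.val_rev]
    omega

variable {a b : ℕ} {v : Fin 4 ⊕ Fin n → Option (Fin a)} {f : Fin n → Fin 4 ⊕ Fin b}

lemma numClasses_glueArc_le [Finite X] [Finite J] (hn : n = 2 * (a + b)) :
    numClasses (fun m m' => m' = glueArc n arc m) ≤
      numClasses (fun d d' => d' = arc d) + (a + b) := by
  rw [numClasses, numClasses, ← Nat.card_fin (a + b), ← Nat.card_sum]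
  refine numClasses_le_card (Sum.elim (Quot.map Sum.inl ?_)
    fun i => Quot.mk _ (.inr (i.castLE (by omega)))) ?_
  · rintro d _ rfl
    rfl
  · rintro (d | j)
    · exact ⟨.inl (Quot.mk _ d), rfl⟩
    · by_cases hj : j.val < a + b
      · exact ⟨.inr ⟨j, hj⟩, rfl⟩
      · refine ⟨.inr ⟨j.rev, by rw [Fin.val_rev]; omega⟩, ?_⟩
        refine Quot.sound ?_
        simp [Fin.ext_iff, Fin.val_rev]
        omega

lemma IsPlanarGluing.vertices (h : IsPlanarGluing w a b v f) [Finite X] [Finite J] :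
    numClasses (fun d d' : Dart X J ⊕ Fin 4 => d' = tangleRot d) + a ≤
      numClasses fun m m' => m' = glueRot w (X := X) (J := J) m := by
  rw [numClasses, ← Nat.card_fin a, ← Nat.card_sum]
  let Q := Quot fun d d' : Dart X J ⊕ Fin 4 => d' = tangleRot d
  have hQ : ∀ d : Dart X J ⊕ Fin 4, (Quot.mk _ (tangleRot d) : Q) = Quot.mk _ d := fun d =>
    (Quot.sound (r := fun d d' => d' = tangleRot d) rfl).symm
  let old : Option (Fin a) → Q ⊕ Fin a := fun y => y.elim (.inl (Quot.mk _ (.inr 0))) .inr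
  let g : (Dart X J ⊕ Fin 4) ⊕ Fin n → Q ⊕ Fin a := fun m => match m with
    | .inl (.inl d) => .inl (Quot.mk _ (.inl d))
    | .inl (.inr i) => old (v (.inl i))
    | .inr j => old (v (.inr j))
  have hg : ∀ x, g (annulusDart x) = old (v x) := by rintro (i | j) <;> rfl
  refine card_le_numClasses g ?_ ?_
  · rintro (q | i)
    · obtain ⟨d, rfl⟩ := Quot.exists_rep q
      rcases d with d | i
      · exact ⟨.inl (.inl d), rfl⟩
      · obtain ⟨x, hx⟩ := h.vertex_surj none
        refine ⟨annulusDart x, ?_⟩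
        rw [hg, hx]
        have h0 := hQ (.inr 0)
        have h1 := hQ (.inr 1)
        have h2 := hQ (.inr 2)
        refine congrArg Sum.inl ?_
        fin_cases i
        · rfl
        · exact h0.symm
        · exact (h1.trans h0).symm
        · exact (h2.trans (h1.trans h0)).symm
    · obtain ⟨x, hx⟩ := h.vertex_surj (some i)
      refine ⟨annulusDart x, ?_⟩
      rw [hg, hx]
      rfl
  · rintro m _ rfl
    induction m using forall_annulus with
    | h1 d =>
      rw [glueRot_inl]
      refine (congrArg Sum.inl (hQ (.inl d)).symm).trans ?_
      rcases d with ⟨c, i⟩ | p <;> rfl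
    | h2 x => rw [glueRot_annulusDart, hg, hg, h.vertex_rot]

lemma IsPlanarGluing.faces (h : IsPlanarGluing w a b v f) [Finite X] [Finite J]
    (harc : ∀ d, arc (arc d) = d) :
    numClasses (fun d d' : Dart X J ⊕ Fin 4 => d' = tangleRot (arc d)) + b ≤
      numClasses fun m m' => m' = glueRot w (X := X) (J := J) (glueArc n arc m) := by
  rw [numClasses, ← Nat.card_fin b, ← Nat.card_sum]
  let Q := Quot fun d d' : Dart X J ⊕ Fin 4 => d' = tangleRot (arc d)
  have hQ : ∀ d : Dart X J ⊕ Fin 4, (Quot.mk _ (arc d) : Q) = Quot.mk _ (tangleRot d) := fun d =>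
    Quot.sound (by rw [harc])
  let old : Fin 4 ⊕ Fin b → Q ⊕ Fin b := Sum.map (fun i => Quot.mk _ (.inr i)) id
  let g : (Dart X J ⊕ Fin 4) ⊕ Fin n → Q ⊕ Fin b :=
    Sum.elim (fun d => .inl (Quot.mk _ d)) fun j => old (f j)
  have hg : ∀ x, g (annulusDart x) = old (Sum.elim Sum.inl f x) := by rintro (i | j) <;> rfl
  have key : ∀ m, g (glueArc n arc m) = g (glueRot w m) := by
    refine forall_annulus (fun d => ?_) fun x => ?_
    · rw [glueRot_inl]
      exact congrArg Sum.inl (hQ (.inl d))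
    · rw [glueRot_annulusDart, hg]
      rcases x with i | j
      · rw [h.face_old]
        exact congrArg Sum.inl (hQ (.inr i))
      · rw [h.face_new]
        rfl
  refine card_le_numClasses g ?_ ?_
  · rintro (q | i)
    · obtain ⟨d, rfl⟩ := Quot.exists_rep q
      exact ⟨.inl d, rfl⟩
    · obtain ⟨j, hj⟩ := h.face_surj i
      refine ⟨.inr j, ?_⟩
      simp [g, hj, old]
  · rintro m _ rfl
    rw [← key, glueArc_glueArc harc]

/-- Every new dart and old end point reaches one base dart through rotations and new arcs alone, so
nothing about the arcs of the inner diagram is needed. -/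
lemma IsPlanarGluing.components (h : IsPlanarGluing w a b v f) [Finite X] [Finite J] :
    numClasses (fun m m' => m' = glueRot w (X := X) (J := J) m ∨ m' = glueArc n arc m) ≤
      numClasses fun d d' : Dart X J ⊕ Fin 4 => d' = tangleRot d ∨ d' = arc d := by
  let r := fun m m' => m' = glueRot w (X := X) (J := J) m ∨ m' = glueArc n arc m
  have hrot : ∀ m, Quot.mk r (glueRot w m) = Quot.mk r m := fun m =>
    (Quot.sound (r := r) (Or.inl rfl)).symm
  have hrot' : ∀ x, Quot.mk r (annulusDart (w.symm (localRot (w x)))) =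
      Quot.mk r (annulusDart x) := fun x => by
    rw [← glueRot_annulusDart, hrot]
  have hiter : ∀ (l : ℕ) x, Quot.mk r (annulusDart ((fun y => w.symm (localRot (w y)))^[l] x)) =
      Quot.mk r (annulusDart x) := by
    intro l
    induction l with
    | zero => exact fun _ => rfl
    | succ l ih => exact fun x => by rw [Function.iterate_succ_apply, ih, hrot']
  have harc' : ∀ x, Quot.mk r (annulusDart (annulusArc x)) = Quot.mk r (annulusDart x) := by
    rintro (i | j)
    · rfl
    · exact (Quot.sound (r := r) (a := .inr j) (Or.inr rfl)).symm
  have hall : ∀ x : Fin 4 ⊕ Fin n, Quot.mk r (annulusDart x) = Quot.mk r (.inl (.inr 0)) := by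
    intro x
    obtain ⟨l, m, hlm⟩ := h.connected x
    rw [← hiter l, ← harc', ← hiter m, hlm]
    rfl
  refine numClasses_le_card (Quot.lift (fun d => Quot.mk r (.inl d)) ?_) ?_
  · rintro d _ (rfl | rfl)
    · rcases d with d | i
      · have := hrot (.inl (.inl d))
        rw [glueRot_inl] at this
        exact this.symm
      · exact (hall (.inl i)).trans (hall (.inl (i + 1))).symm
    · exact Quot.sound (Or.inr rfl)
  · refine forall_annulus (fun d => ⟨Quot.mk _ (.inl d), rfl⟩) fun x => ⟨Quot.mk _ (.inr 0), ?_⟩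
    exact (hall x).symm

/-- One-sided bounds suffice: at least `a` more vertices and `b` more faces, at most `a + b` more
edges and no more components give `V - E + F ≥ 2 C`. The reverse inequality is `euler_le`. -/
lemma IsPlanarGluing.isPlanarMap (h : IsPlanarGluing w a b v f) [Fintype X] [Fintype J]
    (harc : ∀ d, arc (arc d) = d) (hne : ∀ d, arc d ≠ d)
    (hp : IsPlanarMap (tangleRot (X := X) (J := J)) arc) :
    IsPlanarMap (glueRot w (X := X) (J := J)) (glueArc n arc) := by
  have h1 := h.vertices (X := X) (J := J)
  have h2 := h.faces harc
  have h3 := numClasses_glueArc_le (arc := arc) h.card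
  have h4 := h.components (arc := arc)
  have h5 := euler_le (glueRot w (X := X) (J := J)) (glueArc_glueArc (n := n) harc)
    (glueArc_ne ⟨a + b, by rw [h.card, two_mul]⟩ hne)
  unfold IsPlanarMap at *
  omega

end Planarity

lemma IsPlanarMap.congr {D D' : Type} {rot arc : D → D} {rot' arc' : D' → D'} (e : D ≃ D')
    (h : IsPlanarMap rot arc) (hrot : ∀ d, e (rot d) = rot' (e d))
    (harc : ∀ d, e (arc d) = arc' (e d)) : IsPlanarMap rot' arc' := by
  unfold IsPlanarMap at *
  rw [← numClasses_congr (r := fun d d' => d' = rot d) e,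
    ← numClasses_congr (r := fun d d' => d' = rot (arc d)) e,
    ← numClasses_congr (r := fun d d' => d' = arc d) e,
    ← numClasses_congr (r := fun d d' => d' = rot d ∨ d' = arc d) e, h] <;>
  · intro x y
    simp only [← hrot, ← harc, e.apply_eq_iff_eq]

/-! ### State sums of glued diagrams -/

namespace BallTangleDiagram

variable (B : BallTangleDiagram) {a b : ℕ} {v : Fin 4 ⊕ Fin n → Option (Fin a)}
  {f : Fin n → Fin 4 ⊕ Fin b}

/-- The ball tangle diagram obtained by gluing `B` into a diagram in an annulus. -/
def glue (h : IsPlanarGluing w a b v f) : BallTangleDiagram where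
  Crossing := B.Crossing ⊕ Fin k
  Mark := B.Mark
  arc d := glueEquiv w B.Crossing B.Mark
    (glueArc n B.arc ((glueEquiv w B.Crossing B.Mark).symm d))
  arc_arc d := by
    rw [Equiv.symm_apply_apply, glueArc_glueArc B.arc_arc, Equiv.apply_symm_apply]
  arc_ne d h' := glueArc_ne ⟨a + b, by rw [h.card, two_mul]⟩ B.arc_ne _
    ((Equiv.eq_symm_apply _).2 h')
  planar := (h.isPlanarMap B.arc_arc B.arc_ne B.planar).congr (glueEquiv w B.Crossing B.Mark)
    (fun m => by rw [← coe_tangleRotPerm]; simp [glueRot])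
    (fun m => by rw [Equiv.symm_apply_apply])

lemma circles_glue (h : IsPlanarGluing w a b v f) (σ : B.Crossing → Splitting)
    (t : Fin k → Splitting) (s : Splitting) : (B.glue h).circles (Sum.elim σ t) s =
      numClasses fun m m' => m' = glueArc n B.arc m ∨ m' = glueJoin w σ t s m := by
  refine (numClasses_congr (glueEquiv w B.Crossing B.Mark) fun x y => ?_).symm
  simp [glue, glueJoin, Equiv.eq_symm_apply]

/-- Contracting the annulus strands onto old end points by `ρ` turns the split glued diagram into
the split inner diagram with outer splitting `s'`. -/
lemma circles_glue_of_splitsTo (h : IsPlanarGluing w a b v f) {t : Fin k → Splitting}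
    {s s' : Splitting} {ρ : Fin n → Fin 4} (hs : SplitsTo w t s s' ρ)
    (σ : B.Crossing → Splitting) : (B.glue h).circles (Sum.elim σ t) s = B.circles σ s' := by
  rw [circles_glue]
  let r := fun m m' => m' = glueArc n B.arc m ∨ m' = glueJoin w σ t s m
  have hjoin : ∀ x, Quot.mk r (annulusDart (w.symm (localJoin t s (w x)))) =
      Quot.mk r (annulusDart x) := fun x =>
    (Quot.sound (r := r) (Or.inr (glueJoin_annulusDart w σ t s x).symm)).symm
  have harc : ∀ x, Quot.mk r (annulusDart (annulusArc x)) = Quot.mk r (annulusDart x) := by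
    rintro (i | j)
    · rfl
    · exact (Quot.sound (r := r) (a := .inr j) (Or.inl rfl)).symm
  have hiter : ∀ (l : ℕ) x, Quot.mk r (annulusDart
      ((fun y => w.symm (localJoin t s (w (annulusArc y))))^[l] x)) =
        Quot.mk r (annulusDart x) := by
    intro l
    induction l with
    | zero => exact fun _ => rfl
    | succ l ih => exact fun x => by rw [Function.iterate_succ_apply, ih, hjoin, harc]
  have hold : ∀ i, Quot.mk r (annulusDart (.inl (s'.partner i))) =
      Quot.mk r (annulusDart (.inl i)) := by
    intro i
    obtain ⟨l, hl⟩ := hs.old i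
    rw [← hl, hiter, hjoin]
  have hnew : ∀ j, Quot.mk r (annulusDart (.inl (ρ j))) = Quot.mk r (annulusDart (.inr j)) := by
    intro j
    obtain ⟨l, hl⟩ := hs.new j
    rw [← hl, hiter]
  let r' := fun d d' => d' = B.arc d ∨ d' = tangleJoin σ s' d
  have hend : ∀ p q : Fin 4, q = p ∨ q = s'.partner p →
      Quot.mk r' (.inr p) = Quot.mk r' (.inr q) := by
    rintro p _ (rfl | rfl)
    · rfl
    · exact Quot.sound (Or.inr rfl)
  let ρ' : (Dart B.Crossing B.Mark ⊕ Fin 4) ⊕ Fin n → Dart B.Crossing B.Mark ⊕ Fin 4 :=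
    Sum.elim id fun j => .inr (ρ j)
  have hρ' : ∀ x, ρ' (annulusDart x) = .inr (Sum.elim id ρ x) := by rintro (i | j) <;> rfl
  refine numClasses_eq_of_retract Sum.inl ρ' ?_ ?_ (fun _ => rfl) ?_
  · rintro d _ (rfl | rfl)
    · exact Quot.sound (Or.inl rfl)
    · rcases d with d | i
      · exact Quot.sound (Or.inr (glueJoin_inl w σ t s s' d).symm)
      · exact (hold i).symm
  · rintro m _ (rfl | rfl)
    · rcases m with d | j
      · exact Quot.sound (Or.inl rfl)
      · exact hend _ _ (hs.arc j)
    · induction m using forall_annulus with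
      | h1 d =>
        rw [glueJoin_inl w σ t s s' d]
        exact Quot.sound (Or.inr rfl)
      | h2 x =>
        rw [glueJoin_annulusDart, hρ', hρ']
        exact hend _ _ (hs.join x)
  · rintro (d | j)
    · rfl
    · exact hnew j

/-- The circle in the annulus is separate from the strands through the old end points, so there are
at least two circles. -/
lemma circles_glue_of_hasCircle (h : IsPlanarGluing w a b v f) {t : Fin k → Splitting}
    {s : Splitting} {δ : Fin n → Bool} (hs : HasCircle w t s δ)
    (σ : B.Crossing → Splitting) : (B.glue h).circles (Sum.elim σ t) s ≠ 1 := by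
  rw [circles_glue]
  intro h1
  obtain ⟨hs1, -⟩ := Nat.card_eq_one_iff_unique.1 h1
  let g : (Dart B.Crossing B.Mark ⊕ Fin 4) ⊕ Fin n → Bool := Sum.elim (fun _ => false) δ
  have hg : ∀ x, g (annulusDart x) = Sum.elim (fun _ => false) δ x := by rintro (i | j) <;> rfl
  have hinv : ∀ m m', m' = glueArc n B.arc m ∨ m' = glueJoin w σ t s m → g m = g m' := by
    rintro m _ (rfl | rfl)
    · rcases m with d | j
      · rfl
      · exact (hs.arc j).symm
    · induction m using forall_annulus with
      | h1 d => rw [glueJoin_inl w σ t s .A d]; rfl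
      | h2 x => rw [glueJoin_annulusDart, hg, hg, hs.join]
  obtain ⟨j, hj⟩ := hs.nonempty
  have := congrArg (Quot.lift g hinv) (hs1.elim (Quot.mk _ (.inl (.inr 0))) (Quot.mk _ (.inr j)))
  simp [g, hj] at this

lemma stateSum_glue (h : IsPlanarGluing w a b v f) (s : Splitting) :
    (B.glue h).stateSum s = ∑ t : Fin k → Splitting, (∏ i, (t i).weight) *
      ∑ σ : B.Crossing → Splitting,
        if (B.glue h).circles (Sum.elim σ t) s = 1 then ∏ x, (σ x).weight else 0 := by
  have := Fintype.sum_equiv (Equiv.sumArrowEquivProdArrow B.Crossing (Fin k) Splitting)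
    (fun σ => if (B.glue h).circles σ s = 1 then ∏ x : B.Crossing ⊕ Fin k, (σ x).weight else 0)
    (fun p => if (B.glue h).circles (Sum.elim p.1 p.2) s = 1 then
      ∏ x : B.Crossing ⊕ Fin k, (Sum.elim p.1 p.2 x).weight else 0) (fun σ => by
      have e : Sum.elim (Equiv.sumArrowEquivProdArrow B.Crossing (Fin k) Splitting σ).1
        (Equiv.sumArrowEquivProdArrow B.Crossing (Fin k) Splitting σ).2 = σ :=
          (Equiv.sumArrowEquivProdArrow B.Crossing (Fin k) Splitting).symm_apply_apply σ
      simp only [e])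
  refine this.trans ?_
  rw [Fintype.sum_prod_type, Finset.sum_comm]
  refine Finset.sum_congr rfl fun t _ => ?_
  rw [Finset.mul_sum]
  refine Finset.sum_congr rfl fun σ _ => ?_
  rw [Fintype.prod_sum_type, mul_ite, mul_zero, mul_comm]
  rfl

end BallTangleDiagram

end Gluing

/-! ## Rotating, twisting and closing off a ball tangle diagram -/

/-- A quarter turn. -/
def rotationGluing : Fin 4 ⊕ Fin 0 ≃ (Fin 0 × Fin 4) ⊕ Fin 4 where
  toFun := Sum.elim (fun i => .inr (i + 1)) Fin.elim0
  invFun := Sum.elim (fun p => p.1.elim0) fun i => .inl (i - 1)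
  left_inv := by decide
  right_inv := by decide

lemma isPlanarGluing_rotation : IsPlanarGluing (a := 0) (b := 0) rotationGluing
    (fun _ => none) Fin.elim0 := by
  constructor <;> decide

lemma splitsTo_rotation (t : Fin 0 → Splitting) (s : Splitting) :
    SplitsTo rotationGluing t s (match s with | .A => .B | .B => .A) Fin.elim0 := by
  revert t
  cases s <;> exact fun t => ⟨by revert t; decide, fun j => j.elim0, by revert t; decide, fun j => j.elim0⟩

/-- A crossing is added on the right, between the end points `NE` and `SE`.  The darts of the new
crossing are listed in the order `NW`, `SW`, `SE`, `NE`. -/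
def twistGluing : Fin 4 ⊕ Fin 4 ≃ (Fin 1 × Fin 4) ⊕ Fin 4 where
  toFun := Sum.elim ![.inr 0, .inl (0, 0), .inl (0, 1), .inr 3]
    ![.inr 1, .inr 2, .inl (0, 2), .inl (0, 3)]
  invFun := Sum.elim (fun p => ![.inl 1, .inl 2, .inr 2, .inr 3] p.2)
    ![.inl 0, .inr 0, .inr 1, .inl 3]
  left_inv := by decide
  right_inv := by decide

/-- The single new face is the region to the right of the new crossing; the region to its left is
the old one between `NE` and `SE`. -/
lemma isPlanarGluing_twist : IsPlanarGluing (a := 1) (b := 1) twistGluing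
    (Sum.elim ![none, some 0, some 0, none] ![none, none, some 0, some 0])
    ![.inl 1, .inr 0, .inl 3, .inr 0] := by
  constructor <;> decide

lemma splitsTo_twist_numerator : SplitsTo twistGluing ![.B] .A .A ![1, 2, 2, 1] := by
  constructor <;> decide

lemma splitsTo_twist_denominator : SplitsTo twistGluing ![.B] .B .B ![1, 1, 1, 1] := by
  constructor <;> decide

lemma splitsTo_twist_vertical : SplitsTo twistGluing ![.A] .A .B ![0, 0, 0, 0] := by
  constructor <;> decide

lemma hasCircle_twist : HasCircle twistGluing ![.A] .B fun _ => true := by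
  constructor <;> decide

/-- Two crossings side by side are added below, joined to each other by two arcs.  The darts of
the left crossing are listed in the order `NW`, `SW`, `SE`, `NE` and those of the right one in the
order `NE`, `NW`, `SW`, `SE`, so that the two crossings cancel. -/
def stackGluing : Fin 4 ⊕ Fin 8 ≃ (Fin 2 × Fin 4) ⊕ Fin 4 where
  toFun := Sum.elim ![.inr 0, .inr 1, .inl (1, 0), .inl (0, 0)]
    ![.inr 2, .inr 3, .inl (0, 2), .inl (0, 3), .inl (1, 1), .inl (1, 2), .inl (0, 1), .inl (1, 3)]
  invFun := Sum.elim (fun p => (![![.inl 3, .inr 6, .inr 2, .inr 3],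
      ![.inl 2, .inr 4, .inr 5, .inr 7]] : Fin 2 → Fin 4 → Fin 4 ⊕ Fin 8) p.1 p.2)
    ![.inl 0, .inl 1, .inr 0, .inr 1]
  left_inv := by decide
  right_inv := by decide

/-- The new faces are the bigon between the two crossings and the region below them. The crossings
are there for `connected`: a plain cap on the old `SW` and `SE` would not be attached to the outer
vertex by new arcs. -/
lemma isPlanarGluing_stack : IsPlanarGluing (a := 2) (b := 2) stackGluing
    (Sum.elim ![none, none, some 1, some 0]
      ![none, none, some 0, some 0, some 1, some 1, some 0, some 1])
    ![.inl 2, .inr 0, .inr 0, .inr 1, .inl 3, .inr 1, .inl 0, .inr 0] := by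
  constructor <;> decide

lemma hasCircle_stack_numerator : HasCircle stackGluing ![.B, .A] .A
    ![true, true, true, false, false, true, true, true] := by
  constructor <;> decide

lemma splitsTo_stack_denominator : SplitsTo stackGluing ![.B, .A] .B .A
    ![0, 0, 0, 3, 3, 0, 0, 0] := by
  constructor <;> decide

lemma hasCircle_stack_middle (s : Splitting) : HasCircle stackGluing ![.A, .B] s
    ![false, false, true, true, true, true, false, false] := by
  cases s <;> constructor <;> decide

lemma splitsTo_stack_left (s : Splitting) : SplitsTo stackGluing ![.B, .B] s s
    ![2, 3, 3, 3, 3, 3, 3, 2] := by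
  cases s <;> constructor <;> decide

lemma splitsTo_stack_right (s : Splitting) : SplitsTo stackGluing ![.A, .A] s s
    ![2, 3, 2, 2, 2, 2, 3, 2] := by
  cases s <;> constructor <;> decide

/-! ### Effect of the three operations on the state sums -/

lemma sum_splitting (F : Splitting → ℂ) : ∑ s, F s = F .A + F .B :=
  Finset.sum_pair (by decide)

lemma sum_splitting_one (F : (Fin 1 → Splitting) → ℂ) : ∑ t, F t = F ![.A] + F ![.B] := by
  rw [← sum_splitting fun s => F ![s]]
  refine Fintype.sum_equiv (Equiv.funUnique (Fin 1) Splitting) _ _ fun t => congrArg F ?_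
  ext i
  rw [Subsingleton.elim i 0]
  rfl

lemma sum_splitting_two (F : (Fin 2 → Splitting) → ℂ) :
    ∑ t, F t = F ![.A, .A] + F ![.A, .B] + (F ![.B, .A] + F ![.B, .B]) := by
  have : ∑ t, F t = ∑ p : Splitting × Splitting, F ![p.1, p.2] :=
    Fintype.sum_equiv (finTwoArrowEquiv Splitting) _ _ fun t => congrArg F (by
      ext i; fin_cases i <;> rfl)
  rw [this, Fintype.sum_prod_type, sum_splitting, sum_splitting, sum_splitting]

namespace BallTangleDiagram

variable (B : BallTangleDiagram)

lemma sum_of_splitsTo {k n a b : ℕ} {w : Fin 4 ⊕ Fin n ≃ (Fin k × Fin 4) ⊕ Fin 4}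
    {v : Fin 4 ⊕ Fin n → Option (Fin a)} {f : Fin n → Fin 4 ⊕ Fin b}
    (h : IsPlanarGluing w a b v f) {t : Fin k → Splitting} {s s' : Splitting}
    {ρ : Fin n → Fin 4} (hs : SplitsTo w t s s' ρ) :
    (∑ σ : B.Crossing → Splitting, if (B.glue h).circles (Sum.elim σ t) s = 1 then
      ∏ x, (σ x).weight else 0) = B.stateSum s' := by
  simp only [B.circles_glue_of_splitsTo h hs]
  rfl

lemma sum_of_hasCircle {k n a b : ℕ} {w : Fin 4 ⊕ Fin n ≃ (Fin k × Fin 4) ⊕ Fin 4}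
    {v : Fin 4 ⊕ Fin n → Option (Fin a)} {f : Fin n → Fin 4 ⊕ Fin b}
    (h : IsPlanarGluing w a b v f) {t : Fin k → Splitting} {s : Splitting}
    {δ : Fin n → Bool} (hs : HasCircle w t s δ) :
    (∑ σ : B.Crossing → Splitting, if (B.glue h).circles (Sum.elim σ t) s = 1 then
      ∏ x, (σ x).weight else 0) = 0 := by
  simp only [B.circles_glue_of_hasCircle h hs, if_false, Finset.sum_const_zero]

lemma stateSum_rotation : (B.glue isPlanarGluing_rotation).stateSum .A = B.stateSum .B ∧
    (B.glue isPlanarGluing_rotation).stateSum .B = B.stateSum .A := by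
  constructor <;>
  · rw [stateSum_glue, Fintype.sum_unique, B.sum_of_splitsTo _ (splitsTo_rotation _ _)]
    simp

lemma stateSum_twist :
    (B.glue isPlanarGluing_twist).stateSum .A =
      rootA * B.stateSum .B + rootA⁻¹ * B.stateSum .A ∧
    (B.glue isPlanarGluing_twist).stateSum .B = rootA⁻¹ * B.stateSum .B := by
  constructor
  · rw [stateSum_glue, sum_splitting_one, B.sum_of_splitsTo _ splitsTo_twist_vertical,
      B.sum_of_splitsTo _ splitsTo_twist_numerator]
    simp [Splitting.weight]
  · rw [stateSum_glue, sum_splitting_one, B.sum_of_hasCircle _ hasCircle_twist,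
      B.sum_of_splitsTo _ splitsTo_twist_denominator]
    simp [Splitting.weight]

/-- A second Reidemeister move: the states `AA` and `BB` cancel since `A² + A⁻² = 0`, and `AB`
contains a circle. What remains, `BA`, caps off `SW` and `SE` and leaves an arc below. That arc
becomes a separate circle in the numerator closure, and joins `NW` to `NE` in the denominator
closure. -/
lemma stateSum_stack :
    (B.glue isPlanarGluing_stack).stateSum .A = 0 ∧
    (B.glue isPlanarGluing_stack).stateSum .B = B.stateSum .A := by
  have h1 : rootA * rootA + rootA⁻¹ * rootA⁻¹ = 0 := by
    linear_combination -loop_value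
  have h2 : rootA⁻¹ * rootA = 1 := inv_mul_cancel₀ rootA_ne_zero
  constructor
  · rw [stateSum_glue, sum_splitting_two, B.sum_of_splitsTo _ (splitsTo_stack_left _),
      B.sum_of_splitsTo _ (splitsTo_stack_right _), B.sum_of_hasCircle _ hasCircle_stack_numerator,
      B.sum_of_hasCircle _ (hasCircle_stack_middle _)]
    simp only [Fin.prod_univ_two, Splitting.weight, Matrix.cons_val_zero, Matrix.cons_val_one]
    linear_combination B.stateSum .A * h1
  · rw [stateSum_glue, sum_splitting_two, B.sum_of_splitsTo _ (splitsTo_stack_left _),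
      B.sum_of_splitsTo _ (splitsTo_stack_right _), B.sum_of_splitsTo _ splitsTo_stack_denominator,
      B.sum_of_hasCircle _ (hasCircle_stack_middle _)]
    simp only [Fin.prod_univ_two, Splitting.weight, Matrix.cons_val_zero, Matrix.cons_val_one]
    linear_combination B.stateSum .B * h1 + B.stateSum .A * h2

/-- The arcs of the diagram of two horizontal strands. -/
def horizontalArc : Dart Empty Empty ⊕ Fin 4 → Dart Empty Empty ⊕ Fin 4 :=
  Sum.map id (Splitting.partner .A)

lemma forall_end {P : Dart Empty Empty ⊕ Fin 4 → Prop} (h : ∀ i, P (.inr i)) (d) : P d := by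
  rcases d with (⟨c, -⟩ | ⟨j, -⟩) | i
  · exact c.elim
  · exact j.elim
  · exact h i

lemma horizontalArc_horizontalArc : ∀ d, horizontalArc (horizontalArc d) = d :=
  forall_end fun i => congrArg Sum.inr (Splitting.partner_partner .A i)

lemma horizontalArc_ne : ∀ d, horizontalArc d ≠ d :=
  forall_end fun i h => by
    have : ∀ i, Splitting.A.partner i ≠ i := by decide
    exact this i (Sum.inr_injective h)

lemma isPlanarMap_horizontalArc : IsPlanarMap tangleRot horizontalArc := by
  have h1 : Nat.card (Fin 1) ≤ numClasses fun d d' : Dart Empty Empty ⊕ Fin 4 =>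
      d' = tangleRot d :=
    card_le_numClasses (fun _ => 0) (fun i => ⟨.inr 0, Subsingleton.elim _ _⟩) fun _ _ _ => rfl
  have h2 : Nat.card (Fin 3) ≤ numClasses fun d d' => d' = tangleRot (horizontalArc d) := by
    -- The region between the strands meets the outer vertex in two corners, `0` and `2`; the other
    -- two regions have one corner each.
    refine card_le_numClasses (Sum.elim (fun _ => 0) ![0, 1, 0, 2]) ?_ ?_
    · intro i
      fin_cases i
      exacts [⟨.inr 0, rfl⟩, ⟨.inr 1, rfl⟩, ⟨.inr 3, rfl⟩]
    · rintro d _ rfl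
      induction d using forall_end with
      | h i => fin_cases i <;> rfl
  have h3 : numClasses (fun d d' => d' = horizontalArc d) ≤ Nat.card (Fin 2) := by
    refine numClasses_le_card (fun i => Quot.mk _ (.inr (![0, 2] i))) (forall_end fun i => ?_)
    fin_cases i
    exacts [⟨0, rfl⟩, ⟨0, Quot.sound rfl⟩, ⟨1, rfl⟩, ⟨1, Quot.sound rfl⟩]
  have h4 : numClasses (fun d d' => d' = tangleRot d ∨ d' = horizontalArc d) ≤
      Nat.card (Fin 1) := by
    refine numClasses_le_card (fun _ => Quot.mk _ (.inr 0)) (forall_end fun i => ⟨0, ?_⟩)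
    fin_cases i
    · rfl
    · exact Quot.sound (Or.inl rfl)
    · exact (Quot.sound (b := Sum.inr 1) (Or.inl rfl)).trans (Quot.sound (Or.inl rfl))
    · exact (Quot.sound (a := Sum.inr 3) (Or.inl rfl)).symm
  have h5 := euler_le (tangleRotPerm Empty Empty) horizontalArc_horizontalArc horizontalArc_ne
  rw [coe_tangleRotPerm] at h5
  rw [Nat.card_fin] at h1 h2 h3 h4
  unfold IsPlanarMap
  omega

/-- Two horizontal strands without crossings. -/
def horizontal : BallTangleDiagram where
  Crossing := Empty
  Mark := Empty
  arc := horizontalArc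
  arc_arc := horizontalArc_horizontalArc
  arc_ne := horizontalArc_ne
  planar := isPlanarMap_horizontalArc

lemma stateSum_horizontal : horizontal.stateSum .A = 0 ∧ horizontal.stateSum .B = 1 := by
  constructor
  · refine Finset.sum_eq_zero fun σ _ => if_neg fun h => ?_
    obtain ⟨hs, -⟩ := Nat.card_eq_one_iff_unique.1 h
    let g : Dart Empty Empty ⊕ Fin 4 → Bool :=
      Sum.elim (fun _ => false) ![false, false, true, true]
    have hg : ∀ d d', d' = horizontalArc d ∨ d' = tangleJoin σ .A d → g d = g d' := by
      rintro d _ (rfl | rfl) <;>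
      · induction d using forall_end with
        | h i => fin_cases i <;> rfl
    have := congrArg (Quot.lift g hg) (hs.elim (Quot.mk _ (.inr 0)) (Quot.mk _ (.inr 2)))
    exact Bool.false_ne_true this
  · have h : ∀ σ, horizontal.circles σ .B = 1 := by
      intro σ
      refine le_antisymm ?_ (circles_pos _ _ _)
      refine le_trans (numClasses_le_card (Q := Fin 1) (fun _ => Quot.mk _ (.inr 0))
        (forall_end fun i => ⟨0, ?_⟩)) (Nat.card_fin 1).le
      fin_cases i
      · rfl
      · exact Quot.sound (Or.inl rfl)
      · exact (Quot.sound (b := Sum.inr 1) (Or.inl rfl)).trans (Quot.sound (Or.inr rfl))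
      · exact Quot.sound (Or.inr rfl)
    have huniq : (Finset.univ : Finset (horizontal.Crossing → Splitting)).card = 1 := by
      rw [Finset.card_univ]
      exact Fintype.card_eq_one_iff.2 ⟨fun x => x.elim, fun σ => funext fun x => x.elim⟩
    have hprod : ∀ σ : horizontal.Crossing → Splitting, ∏ x, (σ x).weight = 1 := fun σ =>
      Finset.prod_eq_one fun x _ => x.elim
    simp [stateSum, h, hprod, huniq]

end BallTangleDiagram

/-! ### Surjectivity by Euclid's algorithm -/

/-- The column with the entries `p` and `q` is a value of Krebes' invariant. -/
def IsKrebesValue (p q : ℤ) : Prop :=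
  ∃ (B : BallTangleDiagram) (z : ℂ), z ^ 8 = 1 ∧ (p : ℂ) = z * B.stateSum .A ∧
    (q : ℂ) = Complex.I * z * B.stateSum .B

namespace IsKrebesValue

variable {p q : ℤ}

lemma rotate (h : IsKrebesValue p q) : IsKrebesValue q (-p) := by
  obtain ⟨B, z, hz, hp, hq⟩ := h
  refine ⟨B.glue isPlanarGluing_rotation, Complex.I * z, ?_, ?_, ?_⟩
  · rw [mul_pow, hz, mul_one, show (8 : ℕ) = 4 * 2 from rfl, pow_mul, Complex.I_pow_four, one_pow]
  · rw [B.stateSum_rotation.1, hq]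
  · rw [B.stateSum_rotation.2]
    push_cast
    linear_combination -hp - z * B.stateSum .A * Complex.I_mul_I

/-- Multiplying `z` by `A` turns the weights `A, A⁻¹` into `A² = i` and `1`; this `i` is the one in
the second entry. -/
lemma twist (h : IsKrebesValue p q) : IsKrebesValue (p + q) q := by
  obtain ⟨B, z, hz, hp, hq⟩ := h
  have h2 : rootA * rootA⁻¹ = 1 := mul_inv_cancel₀ rootA_ne_zero
  refine ⟨B.glue isPlanarGluing_twist, z * rootA, ?_, ?_, ?_⟩
  · rw [mul_pow, hz, rootA_pow_eight, one_mul]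
  · rw [B.stateSum_twist.1]
    push_cast
    linear_combination hp + hq - z * B.stateSum .B * rootA_sq - z * B.stateSum .A * h2
  · rw [B.stateSum_twist.2]
    linear_combination hq - Complex.I * z * B.stateSum .B * h2

/-- The inverse of the twist matrix is, up to sign, a word in the turn and the twist, so no second
crossing type is needed. -/
lemma untwist (h : IsKrebesValue p q) : IsKrebesValue (p - q) q := by
  have := h.rotate.twist.rotate.twist.rotate
  convert this using 1 <;> ring

lemma closeOff (h : IsKrebesValue p q) : IsKrebesValue 0 p := by
  obtain ⟨B, z, hz, hp, hq⟩ := h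
  refine ⟨B.glue isPlanarGluing_stack, -Complex.I * z, ?_, ?_, ?_⟩
  · rw [mul_pow, hz, mul_one, Even.neg_pow (by decide), show (8 : ℕ) = 4 * 2 from rfl, pow_mul,
      Complex.I_pow_four, one_pow]
  · rw [B.stateSum_stack.1]
    simp
  · rw [B.stateSum_stack.2]
    linear_combination hp + z * B.stateSum .A * Complex.I_mul_I

lemma zero_one : IsKrebesValue 0 1 := by
  refine ⟨.horizontal, -Complex.I, ?_, ?_, ?_⟩
  · rw [Even.neg_pow (by decide), show (8 : ℕ) = 4 * 2 from rfl, pow_mul, Complex.I_pow_four,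
      one_pow]
  · simp [BallTangleDiagram.stateSum_horizontal.1]
  · simp [BallTangleDiagram.stateSum_horizontal.2]

lemma add_mul (h : IsKrebesValue p q) (m : ℤ) : IsKrebesValue (p + m * q) q := by
  induction m using Int.induction_on with
  | zero => simpa using h
  | succ m ih =>
    convert ih.twist using 1
    ring
  | pred m ih =>
    convert ih.untwist using 1
    ring

end IsKrebesValue

lemma isKrebesValue (p q : ℤ) : IsKrebesValue p q := by
  -- Closing off `(m, 1)` produces the gcd `m`.
  have h0 : ∀ m : ℤ, IsKrebesValue 0 m := fun m => by
    simpa using (IsKrebesValue.zero_one.add_mul m).closeOff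
  induction h : q.natAbs using Nat.strong_induction_on generalizing p q with
  | _ n ih =>
    by_cases hq : q = 0
    · subst hq
      simpa using (h0 p).rotate
    · have hlt : (p % q).natAbs < n := by
        rw [← h]
        zify
        rw [abs_of_nonneg (Int.emod_nonneg p hq)]
        exact Int.emod_lt_abs p hq
      -- One division step: the quarter turn of `(-q, p % q)` is `(p % q, q)`, and `p / q` twists
      -- lead to `(p, q)`.
      have h1 := (ih _ hlt (-q) (p % q) rfl).rotate.add_mul (p / q)
      rwa [neg_neg, mul_comm, Int.emod_add_mul_ediv] at h1

end

/-- Krebes' ball tangle invariant is a well-defined map from ball tangle diagrams to `PM 2 1`, and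
it is surjective. -/
theorem theorem4p4 :
    ∃ f : BallTangleDiagram → PM 2 1, IsKrebesInvariant f ∧ Function.Surjective f := by
  obtain ⟨f, hf⟩ := exists_isKrebesInvariant
  refine ⟨f, hf, surjective_of_forall_mem_krebesSet hf fun M => ?_⟩
  obtain ⟨B, hB⟩ := isKrebesValue (M 0 0) (M 1 0)
  exact ⟨B, B.mem_krebesSet.2 hB⟩
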